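/- **Setting.** Let $\mathbb Q[[x_1,x_2,\dots;\theta_1,\theta_2,\dots]]$ be the ring of formal power series over $\mathbb Q$ in commuting variables $x_i$ and anticommuting variables $\theta_i$ ($\theta_i\theta_j=-\theta_j\theta_i$, $\theta_i^2=0$, $x_i\theta_j=\theta_jx_i$). A *dotted composition* $\alpha=(\alpha_1,\dots,\alpha_l)$ is a finite (possibly empty) sequence with entries in $\{1,2,3,\dots\}\cup\{\dot 0,\dot 1,\dot 2,\dots\}$; put $\eta_i=1$ if $\alpha_i$ is dotted and $\eta_i=0$ otherwise, and ignore dots in exponents. Let ${\rm sQSym}$ be the set of series $f$ of bounded degree such that for each dotted composition $\alpha$ all the monomials $\theta_{i_1}^{\eta_1}\cdots\theta_{i_l}^{\eta_l}x_{i_1}^{\alpha_1}\cdots x_{i_l}^{\alpha_l}$ with $i_1<\dots<i_l$ have the same coefficient in $f$; it is a $\mathbb Q$-subalgebra. It contains $$M_\alpha=\sum_{i_1<\cdots<i_l}\theta_{i_1}^{\eta_1}\cdots\theta_{i_l}^{\eta_l}x_{i_1}^{\alpha_1}\cdots x_{i_l}^{\alpha_l}.$$ The total degree is the degree in the $x_i$,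 the fermionic degree is the degree in the $\theta_i$, and ${\rm sQSym}_n$ is the sum of the subspaces of total degree $k$ and fermionic degree $i$ with $k+i=n$. The tensor product ${\rm sQSym}\otimes_{\mathbb Q}{\rm sQSym}$ carries the product $(f_1\otimes g_1)(f_2\otimes g_2)=(-1)^{ab}f_1f_2\otimes g_1g_2$ for $g_1,f_2$ of fermionic degrees $a,b$. Identify $f\otimes g$ with $f(x;\theta)g(y;\phi)$, where all the $\theta_i,\phi_j$ anticommute. The coproduct is defined by $(\Delta f)(x,y;\theta,\phi)=f(x,y;\theta,\phi)$, the evaluation of $f$ at the ordered alphabet $x_1<x_2<\cdots<y_1<y_2<\cdots$, $\theta_1<\theta_2<\cdots<\phi_1<\phi_2<\cdots$; the counit $\epsilon$ takes the constant term. For a superpartition $(\Lambda^a;\Lambda^s)=(\Lambda_1,\dots,\Lambda_m;\Lambda_{m+1},\dots,\Lambda_N)$ (with $\Lambda_1>\dots>\Lambda_m\ge 0$ and $\Lambda^s$ a partition), let $m_\Lambda$ be the sum of the distinct terms $\theta_{i_1}\cdots\theta_{i_m}x_{i_1}^{\Lambda_1}\cdots x_{i_N}^{\Lambda_N}$ with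 $i_1,\dots,i_N$ distinct. The ring $\mathbf\Lambda$ of symmetric functions in superspace is the $\mathbb Q$-span of the $m_\Lambda$. Its coproduct is likewise $f\mapsto f(x,y;\theta,\phi)\in\mathbf\Lambda\otimes\mathbf\Lambda$, and $p_r=\sum_i x_i^r$ ($r\ge1$), $\tilde p_k=\sum_i\theta_ix_i^k$ ($k\ge0$). **Statement.** The map $f\otimes g\mapsto f(x;\theta)g(y;\phi)$ is injective on ${\rm sQSym}\otimes{\rm sQSym}$, and $f(x,y;\theta,\phi)$ lies in its image for every $f\in{\rm sQSym}$, so that $\Delta$ is well defined. Moreover: 1. For every dotted composition $\alpha=(\alpha_1,\dots,\alpha_l)$, $$\Delta(M_\alpha)=\sum_{\beta\cdot\gamma=\alpha}M_\beta\otimes M_\gamma=\sum_{k=0}^{l}M_{\alpha_1,\dots,\alpha_k}\otimes M_{\alpha_{k+1},\dots,\alpha_l},$$ where $\beta\cdot\gamma$ denotes concatenation. 2. With $\Delta$ and $\epsilon$, ${\rm sQSym}$ is a Hopf algebra in the graded sense: $\Delta$ is coassociative with counit $\epsilon$, $\Delta$ and $\epsilon$ are algebra morphisms (for the signed product on ${\rm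 sQSym}\otimes{\rm sQSym}$), and there is an antipode $S$, with $m\circ(S\otimes 1)\circ\Delta=u\circ\epsilon=m\circ(1\otimes S)\circ\Delta$, where $m$ is the product and $u$ the unit map; $\Delta$ and $S$ preserve the fermionic degree. It is commutative in the graded sense: $fg=(-1)^{ab}gf$ if $f,g$ have fermionic degrees $a,b$. It is graded by the subspaces ${\rm sQSym}_n$, that is, ${\rm sQSym}=\bigoplus_{n\ge0}{\rm sQSym}_n$, ${\rm sQSym}_i\,{\rm sQSym}_j\subseteq{\rm sQSym}_{i+j}$, $1\in{\rm sQSym}_0$ and $\Delta({\rm sQSym}_n)\subseteq\bigoplus_{i+j=n}{\rm sQSym}_i\otimes{\rm sQSym}_j$; and it is connected: $\dim_{\mathbb Q}{\rm sQSym}_0=1$. 3. $\mathbf\Lambda$ is a Hopf subalgebra of ${\rm sQSym}$: it is contained in ${\rm sQSym}$, it is a subalgebra, it contains the components of each fermionic degree of its elements, $\Delta(\mathbf\Lambda)\subseteq\mathbf\Lambda\otimes\mathbf\Lambda$, $S(\mathbf\Lambda)\subseteq\mathbf\Lambda$, and the restriction of $\Delta$ to $\mathbf\Lambda$ is the coproduct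 of $\mathbf\Lambda$. Furthermore $p_r=M_{(r)}\in\mathbf\Lambda$ for $r\ge1$ and $\tilde p_k=M_{(\dot k)}\in\mathbf\Lambda$ for $k\ge0$. -/

import Mathlib

open scoped TensorProduct

/-- The ring `ℚ[[x_i, θ_i : i ∈ I]]` of formal power series in commuting variables `x_i` and
anticommuting variables `θ_i` indexed by a linearly ordered set `I`. A series is written
`∑_S θ_S f_S`, where `S = {i₁ < ⋯ < iₘ}` runs over the finite subsets of `I`,
`θ_S = θ_{i₁} ⋯ θ_{iₘ}`, and `f_S` is a power series in the `x_i`; it is stored as `S ↦ f_S`. -/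
def SuperSeries (I : Type) : Type := Finset I → MvPowerSeries I ℚ

namespace SuperSeries

variable {I J : Type}

noncomputable instance : AddCommGroup (SuperSeries I) :=
  inferInstanceAs (AddCommGroup (Finset I → MvPowerSeries I ℚ))

noncomputable instance : Module ℚ (SuperSeries I) :=
  inferInstanceAs (Module ℚ (Finset I → MvPowerSeries I ℚ))

/-- The coefficient of the monomial `θ_S x^a`. -/
noncomputable def coeff (S : Finset I) (a : I →₀ ℕ) : SuperSeries I →ₗ[ℚ] ℚ :=
  (MvPowerSeries.coeff a).comp (LinearMap.proj S)

theorem ext_coeff {f g : SuperSeries I} (h : ∀ S a, coeff S a f = coeff S a g) : f = g :=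
  funext fun S => MvPowerSeries.ext fun a => h S a

theorem add_apply (f g : SuperSeries I) (S : Finset I) : (f + g) S = f S + g S := rfl
theorem smul_apply (c : ℚ) (f : SuperSeries I) (S : Finset I) : (c • f) S = c • f S := rfl
theorem zero_apply (S : Finset I) : (0 : SuperSeries I) S = 0 := rfl

/-- The series with prescribed coefficients. -/
noncomputable def ofCoeff (c : Finset I → (I →₀ ℕ) → ℚ) : SuperSeries I := c

theorem coeff_ofCoeff (c : Finset I → (I →₀ ℕ) → ℚ) (S : Finset I) (a : I →₀ ℕ) :
    coeff S a (ofCoeff c) = c S a := rfl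

variable [LinearOrder I] [LinearOrder J]

/-- For disjoint `T` and `U` one has `θ_T θ_U = sgn T U • θ_{T ∪ U}`. -/
def sgn (T U : Finset I) : ℚ := (-1) ^ ((T ×ˢ U).filter fun p => p.2 < p.1).card

theorem sgn_empty_left (U : Finset I) : sgn ∅ U = 1 := by simp [sgn]
theorem sgn_empty_right (U : Finset I) : sgn U ∅ = 1 := by simp [sgn]

theorem sgn_union_left {T T' : Finset I} (U : Finset I) (h : Disjoint T T') :
    sgn (T ∪ T') U = sgn T U * sgn T' U := by
  unfold sgn
  rw [← pow_add, Finset.union_product, Finset.filter_union, Finset.card_union_of_disjoint]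
  exact Finset.disjoint_filter_filter (Finset.disjoint_product.2 (Or.inl h))

theorem sgn_union_right {T T' : Finset I} (U : Finset I) (h : Disjoint T T') :
    sgn U (T ∪ T') = sgn U T * sgn U T' := by
  unfold sgn
  rw [← pow_add, Finset.product_union, Finset.filter_union, Finset.card_union_of_disjoint]
  exact Finset.disjoint_filter_filter (Finset.disjoint_product.2 (Or.inr h))

/-- The product determined by `θ_i θ_j = - θ_j θ_i` (so `θ_i ^ 2 = 0`), the `x_i` being central. -/
noncomputable instance : Mul (SuperSeries I) where
  mul f g := fun S => ∑ T ∈ S.powerset, sgn T (S \ T) • (f T * g (S \ T))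

noncomputable instance : One (SuperSeries I) where
  one := fun S => if S = ∅ then 1 else 0

theorem mul_apply (f g : SuperSeries I) (S : Finset I) :
    (f * g) S = ∑ T ∈ S.powerset, sgn T (S \ T) • (f T * g (S \ T)) := rfl

theorem one_apply (S : Finset I) : (1 : SuperSeries I) S = if S = ∅ then 1 else 0 := rfl

theorem mul_assoc' (f g h : SuperSeries I) : f * g * h = f * (g * h) := by
  funext S
  simp only [mul_apply, Finset.smul_sum, Finset.sum_mul, Finset.mul_sum, smul_mul_assoc,
    mul_smul_comm, smul_smul]
  rw [Finset.sum_sigma', Finset.sum_sigma']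
  refine Finset.sum_bij' (fun p _ => ⟨p.2, p.1 \ p.2⟩) (fun q _ => ⟨q.1 ∪ q.2, q.1⟩) ?_ ?_ ?_ ?_ ?_
  · rintro ⟨T, U⟩ h
    simp only [Finset.mem_sigma, Finset.mem_powerset] at h ⊢
    exact ⟨h.2.trans h.1, Finset.sdiff_subset_sdiff h.1 le_rfl⟩
  · rintro ⟨U, V⟩ h
    simp only [Finset.mem_sigma, Finset.mem_powerset] at h ⊢
    exact ⟨Finset.union_subset h.1 (h.2.trans Finset.sdiff_subset), Finset.subset_union_left⟩
  · rintro ⟨T, U⟩ h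
    simp only [Finset.mem_sigma, Finset.mem_powerset] at h ⊢
    rw [Finset.union_sdiff_of_subset h.2]
  · rintro ⟨U, V⟩ h
    simp only [Finset.mem_sigma, Finset.mem_powerset] at h ⊢
    have : (U ∪ V) \ U = V := by
      rw [Finset.union_sdiff_left, Finset.sdiff_eq_self_iff_disjoint]
      exact (Finset.disjoint_of_subset_left h.2 Finset.sdiff_disjoint)
    rw [this]
  · rintro ⟨T, U⟩ h
    simp only [Finset.mem_sigma, Finset.mem_powerset] at h ⊢
    obtain ⟨hT, hU⟩ := h
    have e1 : (S \ U) \ (T \ U) = S \ T := by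
      ext x; simp only [Finset.mem_sdiff]
      have := @hU x
      tauto
    have e2 : S \ U = (T \ U) ∪ (S \ T) := by
      ext x; simp only [Finset.mem_sdiff, Finset.mem_union]
      have := @hU x
      have := @hT x
      tauto
    have d : Disjoint (T \ U) (S \ T) :=
      Finset.disjoint_of_subset_left Finset.sdiff_subset Finset.disjoint_sdiff
    have e3 := sgn_union_left (S \ T) (Finset.disjoint_sdiff (s := U) (t := T))
    rw [Finset.union_sdiff_of_subset hU] at e3
    rw [e1, mul_assoc (f U), e3, e2, sgn_union_right _ d]
    congr 1
    ring

noncomputable instance : Ring (SuperSeries I) :=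
  { (inferInstance : AddCommGroup (SuperSeries I)), (inferInstance : Mul (SuperSeries I)),
    (inferInstance : One (SuperSeries I)) with
  left_distrib f g h := by
    funext S
    simp only [mul_apply, add_apply, mul_add, smul_add, Finset.sum_add_distrib]
  right_distrib f g h := by
    funext S
    simp only [mul_apply, add_apply, add_mul, smul_add, Finset.sum_add_distrib]
  zero_mul f := by
    funext S
    simp [mul_apply, zero_apply]
  mul_zero f := by
    funext S
    simp [mul_apply, zero_apply]
  mul_assoc := mul_assoc'
  one_mul f := by
    funext S
    rw [mul_apply, Finset.sum_eq_single ∅]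
    · simp [one_apply, sgn_empty_left]
    · intro T _ hT
      simp [one_apply, hT]
    · simp
  mul_one f := by
    funext S
    rw [mul_apply, Finset.sum_eq_single S]
    · simp [one_apply, sgn_empty_right]
    · intro T hT hTS
      rw [Finset.mem_powerset] at hT
      have : S \ T ≠ ∅ := fun h => hTS (hT.antisymm (Finset.sdiff_eq_empty_iff_subset.1 h))
      simp [one_apply, this]
    · simp }

noncomputable instance : Algebra ℚ (SuperSeries I) :=
  Algebra.ofModule
    (fun c f g => by
      funext S
      simp only [mul_apply, smul_apply, Finset.smul_sum, smul_mul_assoc, smul_comm c])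
    (fun c f g => by
      funext S
      simp only [mul_apply, smul_apply, Finset.smul_sum, mul_smul_comm, smul_comm c])

theorem coeff_mul (f g : SuperSeries I) (S : Finset I) (a : I →₀ ℕ) :
    coeff S a (f * g) = ∑ T ∈ S.powerset, ∑ p ∈ Finset.HasAntidiagonal.antidiagonal a,
      sgn T (S \ T) * (coeff T p.1 f * coeff (S \ T) p.2 g) := by
  change MvPowerSeries.coeff a ((f * g) S) = _
  rw [mul_apply, map_sum]
  refine Finset.sum_congr rfl fun T _ => ?_
  rw [map_smul, MvPowerSeries.coeff_mul, smul_eq_mul, Finset.mul_sum]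
  rfl

theorem coeff_one (S : Finset I) (a : I →₀ ℕ) :
    coeff S a (1 : SuperSeries I) = if S = ∅ ∧ a = 0 then 1 else 0 := by
  classical
  change MvPowerSeries.coeff a ((1 : SuperSeries I) S) = _
  rw [one_apply]
  by_cases h : S = ∅ <;> simp [h, MvPowerSeries.coeff_one]

/-- Set to zero the variables outside the image of `e`. -/
noncomputable def restrict (e : J ↪o I) (f : SuperSeries I) : SuperSeries J :=
  fun S a => coeff (S.map e.toEmbedding) (a.embDomain e.toEmbedding) f

theorem coeff_restrict (e : J ↪o I) (f : SuperSeries I) (S : Finset J) (a : J →₀ ℕ) :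
    coeff S a (restrict e f) = coeff (S.map e.toEmbedding) (a.embDomain e.toEmbedding) f := rfl

theorem sgn_map (e : J ↪o I) (T U : Finset J) :
    sgn (T.map e.toEmbedding) (U.map e.toEmbedding) = sgn T U := by
  unfold sgn
  congr 1
  rw [← Finset.card_map (e.toEmbedding.prodMap e.toEmbedding)]
  congr 1
  ext ⟨x, y⟩
  simp only [Finset.mem_filter, Finset.mem_product, Finset.mem_map, Prod.exists,
    Function.Embedding.prodMap, Function.Embedding.coeFn_mk, Prod.map_apply, Prod.mk.injEq]
  constructor
  · rintro ⟨⟨⟨t, ht, rfl⟩, u, hu, rfl⟩, h⟩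
    exact ⟨t, u, ⟨⟨ht, hu⟩, e.lt_iff_lt.1 h⟩, rfl, rfl⟩
  · rintro ⟨t, u, ⟨⟨ht, hu⟩, h⟩, rfl, rfl⟩
    exact ⟨⟨⟨t, ht, rfl⟩, u, hu, rfl⟩, e.lt_iff_lt.2 h⟩

theorem restrict_mul (e : J ↪o I) (f g : SuperSeries I) :
    restrict e (f * g) = restrict e f * restrict e g := by
  refine ext_coeff fun S a => ?_
  rw [coeff_restrict, coeff_mul, coeff_mul]
  have hp : (S.map e.toEmbedding).powerset = S.powerset.map (Finset.mapEmbedding e.toEmbedding).toEmbedding := by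
    ext T
    simp only [Finset.mem_powerset, Finset.mem_map, RelEmbedding.coe_toEmbedding,
      Finset.mapEmbedding_apply]
    rw [Finset.subset_map_iff]
    constructor
    · rintro ⟨u, hu, rfl⟩; exact ⟨u, hu, rfl⟩
    · rintro ⟨u, hu, rfl⟩; exact ⟨u, hu, rfl⟩
  rw [hp, Finset.sum_map]
  refine Finset.sum_congr rfl fun T _ => ?_
  rw [← Finsupp.image_prodMap_embDomain_antidiagonal, Finset.sum_image]
  · refine Finset.sum_congr rfl fun p _ => ?_
    simp only [RelEmbedding.coe_toEmbedding, Finset.mapEmbedding_apply, Prod.map_fst,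
      Prod.map_snd, coeff_restrict, ← Finset.map_sdiff, sgn_map]
  · exact fun p _ q _ h => (Prod.map_injective.2
      ⟨Finsupp.embDomain_injective _, Finsupp.embDomain_injective _⟩) h

/-- The dotted composition of the monomial `θ_S x^a`: the list of its exponents, for increasing
indices, an entry `(n, true)` being the dotted part `ṅ` and `(n, false)` the undotted part `n`. So
`θ_S x^a = θ_{i₁}^{η₁} ⋯ θ_{iₗ}^{ηₗ} x_{i₁}^{α₁} ⋯ x_{iₗ}^{αₗ}` with `i₁ < ⋯ < iₗ` and
`α = shape S a`. -/
def shape (S : Finset I) (a : I →₀ ℕ) : List (ℕ × Bool) :=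
  ((a.support ∪ S).sort).map fun i => (a i, decide (i ∈ S))

theorem shape_map (e : J ↪o I) (S : Finset J) (a : J →₀ ℕ) :
    shape (S.map e.toEmbedding) (a.embDomain e.toEmbedding) = shape S a := by
  unfold shape
  rw [Finsupp.support_embDomain, ← Finset.map_union,
    ← StrictMonoOn.map_finsetSort e.toEmbedding _ (e.strictMono.strictMonoOn _), List.map_map]
  refine List.map_congr_left fun i _ => ?_
  have := Finsupp.embDomain_apply_self e.toEmbedding a i
  simp only [RelEmbedding.coe_toEmbedding] at this
  simp [this]

theorem exists_of_shape_eq {S S' : Finset I} {a a' : I →₀ ℕ} (h : shape S a = shape S' a') :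
    ∃ (l : ℕ) (e e' : Fin l ↪o I) (T : Finset (Fin l)) (b : Fin l →₀ ℕ),
      S = T.map e.toEmbedding ∧ a = b.embDomain e.toEmbedding ∧
      S' = T.map e'.toEmbedding ∧ a' = b.embDomain e'.toEmbedding := by
  have hc : (a'.support ∪ S').card = (a.support ∪ S).card := by
    have := congrArg List.length h
    simpa [shape] using this.symm
  set l := (a.support ∪ S).card with hl
  set e := (a.support ∪ S).orderEmbOfFin hl.symm with he
  set e' := (a'.support ∪ S').orderEmbOfFin hc with he'
  have key : ∀ k, a (e k) = a' (e' k) ∧ (e k ∈ S ↔ e' k ∈ S') := by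
    unfold shape at h
    rw [← Finset.listMap_orderEmbOfFin_finRange _ hl.symm,
      ← Finset.listMap_orderEmbOfFin_finRange _ hc, List.map_map, List.map_map] at h
    intro k
    have := List.map_inj_left.1 h k (List.mem_finRange k)
    simpa using this
  have r : Set.range e = ↑(a.support ∪ S) := Finset.range_orderEmbOfFin _ _
  have r' : Set.range e' = ↑(a'.support ∪ S') := Finset.range_orderEmbOfFin _ _
  refine ⟨l, e, e', Finset.univ.filter (fun k => e k ∈ S),
    a.comapDomain e e.injective.injOn, ?_, ?_, ?_, ?_⟩
  · ext i
    simp only [Finset.mem_map, Finset.mem_filter, Finset.mem_univ, true_and]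
    constructor
    · intro hi
      have : i ∈ Set.range e := by rw [r]; simp [hi]
      obtain ⟨k, rfl⟩ := this
      exact ⟨k, hi, rfl⟩
    · rintro ⟨k, hk, rfl⟩; exact hk
  · refine (Finsupp.embDomain_comapDomain (f := e.toEmbedding) ?_).symm
    change _ ⊆ Set.range e
    rw [r]; simp
  · ext i
    simp only [Finset.mem_map, Finset.mem_filter, Finset.mem_univ, true_and]
    constructor
    · intro hi
      have : i ∈ Set.range e' := by rw [r']; simp [hi]
      obtain ⟨k, rfl⟩ := this
      exact ⟨k, (key k).2.2 hi, rfl⟩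
    · rintro ⟨k, hk, rfl⟩; exact (key k).2.1 hk
  · have : a.comapDomain e e.injective.injOn = a'.comapDomain e' e'.injective.injOn := by
      ext k; simpa using (key k).1
    rw [this]
    refine (Finsupp.embDomain_comapDomain (f := e'.toEmbedding) ?_).symm
    change _ ⊆ Set.range e'
    rw [r']; simp

end SuperSeries

open SuperSeries

theorem SuperSeries.shape_card {I : Type} [LinearOrder I] (S : Finset I) (a : I →₀ ℕ) :
    ((shape S a).map fun p => if p.2 then 1 else 0).sum = S.card := by
  rw [shape, List.map_map, ← Multiset.sum_coe, ← Multiset.map_coe, Finset.sort_eq]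
  change ∑ i ∈ a.support ∪ S, _ = _
  simp

theorem SuperSeries.shape_degree {I : Type} [LinearOrder I] (S : Finset I) (a : I →₀ ℕ) :
    ((shape S a).map Prod.fst).sum = a.degree := by
  rw [shape, List.map_map, ← Multiset.sum_coe, ← Multiset.map_coe, Finset.sort_eq]
  change ∑ i ∈ a.support ∪ S, a i = _
  rw [Finsupp.degree_apply]
  refine (Finset.sum_subset Finset.subset_union_left fun i _ hi => ?_).symm
  simpa using hi

theorem SuperSeries.card_eq_of_shape_eq {I J : Type} [LinearOrder I] [LinearOrder J]
    {S : Finset I} {a : I →₀ ℕ} {S' : Finset J} {a' : J →₀ ℕ} (h : shape S a = shape S' a') :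
    S.card = S'.card := by
  rw [← shape_card S a, h, shape_card]

theorem SuperSeries.degree_eq_of_shape_eq {I J : Type} [LinearOrder I] [LinearOrder J]
    {S : Finset I} {a : I →₀ ℕ} {S' : Finset J} {a' : J →₀ ℕ} (h : shape S a = shape S' a') :
    a.degree = a'.degree := by
  rw [← shape_degree S a, h, shape_degree]

/-- A series has finite degree if the degrees (in the `x` and the `θ` together) of the monomials
that occur in it are bounded. -/
def HasFiniteDegree {I : Type} (f : SuperSeries I) : Prop :=
  ∃ d, ∀ S a, coeff S a f ≠ 0 → a.degree + S.card ≤ d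

/-- For every dotted composition `α`, all the monomials
`θ_{i₁}^{η₁} ⋯ θ_{iₗ}^{ηₗ} x_{i₁}^{α₁} ⋯ x_{iₗ}^{αₗ}` with `i₁ < ⋯ < iₗ` have the same coefficient
in `f`. -/
def IsQuasisymmetric {I : Type} [LinearOrder I] (f : SuperSeries I) : Prop :=
  ∀ S a S' a', shape S a = shape S' a' → coeff S a f = coeff S' a' f

theorem IsQuasisymmetric.mul {I : Type} [LinearOrder I] {f g : SuperSeries I}
    (hf : IsQuasisymmetric f) (hg : IsQuasisymmetric g) : IsQuasisymmetric (f * g) := by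
  intro S a S' a' h
  obtain ⟨l, e, e', T, b, rfl, rfl, rfl, rfl⟩ := exists_of_shape_eq h
  have key : ∀ k, IsQuasisymmetric k → restrict e k = restrict e' k := fun k hk =>
    ext_coeff fun T b => hk _ _ _ _ (by rw [shape_map, shape_map])
  rw [← coeff_restrict, ← coeff_restrict, restrict_mul, restrict_mul, key f hf, key g hg]

theorem SuperSeries.exists_of_coeff_mul_ne_zero {I : Type} [LinearOrder I] {f g : SuperSeries I}
    {S : Finset I} {a : I →₀ ℕ} (h : coeff S a (f * g) ≠ 0) :
    ∃ T U b c, coeff T b f ≠ 0 ∧ coeff U c g ≠ 0 ∧ T.card + U.card = S.card ∧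
      b.degree + c.degree = a.degree := by
  rw [coeff_mul] at h
  obtain ⟨T, hT, h⟩ := Finset.exists_ne_zero_of_sum_ne_zero h
  obtain ⟨⟨b, c⟩, hp, h⟩ := Finset.exists_ne_zero_of_sum_ne_zero h
  refine ⟨T, S \ T, b, c, left_ne_zero_of_mul (right_ne_zero_of_mul h),
    right_ne_zero_of_mul (right_ne_zero_of_mul h), ?_, ?_⟩
  · rw [add_comm]; exact Finset.card_sdiff_add_card_eq_card (Finset.mem_powerset.1 hT)
  · rw [← map_add, Finset.HasAntidiagonal.mem_antidiagonal.1 hp]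

/-- The algebra of quasisymmetric functions in superspace, in the variables `x_0, x_1, …` and
`θ_0, θ_1, …`. -/
noncomputable def sQSym : Subalgebra ℚ (SuperSeries ℕ) where
  carrier := {f | HasFiniteDegree f ∧ IsQuasisymmetric f}
  mul_mem' := by
    rintro f g ⟨⟨d, hd⟩, hf⟩ ⟨⟨d', hd'⟩, hg⟩
    refine ⟨⟨d + d', fun S a h => ?_⟩, hf.mul hg⟩
    obtain ⟨T, U, b, c, h1, h2, h3, h4⟩ := exists_of_coeff_mul_ne_zero h
    have := hd _ _ h1
    have := hd' _ _ h2
    omega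
  add_mem' := by
    rintro f g ⟨⟨d, hd⟩, hf⟩ ⟨⟨d', hd'⟩, hg⟩
    refine ⟨⟨d + d', fun S a h => ?_⟩, fun S a S' a' h => ?_⟩
    · rw [map_add] at h
      by_cases h0 : coeff S a f = 0
      · rw [h0, zero_add] at h
        exact (hd' _ _ h).trans (Nat.le_add_left _ _)
      · exact (hd _ _ h0).trans (Nat.le_add_right _ _)
    · rw [map_add, map_add, hf _ _ _ _ h, hg _ _ _ _ h]
  algebraMap_mem' := by
    intro r
    rw [Algebra.algebraMap_eq_smul_one]
    refine ⟨⟨0, fun S a h => ?_⟩, fun S a S' a' h => ?_⟩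
    · rw [map_smul, coeff_one] at h
      by_cases hh : S = ∅ ∧ a = 0
      · simp [hh.1, hh.2]
      · simp [hh] at h
    · have hS := card_eq_of_shape_eq h
      have ha := degree_eq_of_shape_eq h
      simp only [map_smul, coeff_one, ← Finset.card_eq_zero, ← Finsupp.degree_eq_zero_iff, hS, ha]

namespace sQSym

/-- The subspace of fermionic degree `m`. -/
def fermionic (m : ℕ) : Submodule ℚ sQSym where
  carrier := {f | ∀ S a, coeff S a (f : SuperSeries ℕ) ≠ 0 → S.card = m}
  zero_mem' := fun S a h => absurd (map_zero _) h
  add_mem' := by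
    intro f g hf hg S a h
    by_cases h0 : coeff S a (f : SuperSeries ℕ) = 0
    · refine hg S a fun h1 => h ?_
      rw [Subalgebra.coe_add, map_add, h0, h1, add_zero]
    · exact hf S a h0
  smul_mem' := by
    intro c f hf S a h
    refine hf S a fun h1 => h ?_
    rw [Subalgebra.coe_smul, map_smul, h1, smul_zero]

/-- The subspace of total degree `n` and fermionic degree `m`. -/
def bihomogeneous (n m : ℕ) : Submodule ℚ sQSym where
  carrier := {f | ∀ S a, coeff S a (f : SuperSeries ℕ) ≠ 0 → a.degree = n ∧ S.card = m}
  zero_mem' := fun S a h => absurd (map_zero _) h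
  add_mem' := by
    intro f g hf hg S a h
    by_cases h0 : coeff S a (f : SuperSeries ℕ) = 0
    · refine hg S a fun h1 => h ?_
      rw [Subalgebra.coe_add, map_add, h0, h1, add_zero]
    · exact hf S a h0
  smul_mem' := by
    intro c f hf S a h
    refine hf S a fun h1 => h ?_
    rw [Subalgebra.coe_smul, map_smul, h1, smul_zero]

/-- The sum of the subspaces of total degree `k` and fermionic degree `i` with `k + i = n`. -/
noncomputable def homogeneous (n : ℕ) : Submodule ℚ sQSym :=
  ⨆ p ∈ Finset.HasAntidiagonal.antidiagonal n, bihomogeneous p.1 p.2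

/-- The component of fermionic degree `m`. -/
noncomputable def component (m : ℕ) : sQSym →ₗ[ℚ] fermionic m where
  toFun f := ⟨⟨ofCoeff fun S a => if S.card = m then coeff S a (f : SuperSeries ℕ) else 0, by
      obtain ⟨⟨d, hd⟩, hf⟩ := f.2
      refine ⟨⟨d, fun S a h => ?_⟩, fun S a S' a' h => ?_⟩
      · rw [coeff_ofCoeff] at h
        exact hd S a fun h0 => h (by simp [h0])
      · have hS := card_eq_of_shape_eq h
        rw [coeff_ofCoeff, coeff_ofCoeff, hS, hf _ _ _ _ h]⟩, by
      intro S a h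
      by_contra hS
      simp [coeff_ofCoeff, hS] at h⟩
  map_add' f g := by
    refine Subtype.ext (Subtype.ext (ext_coeff fun S a => ?_))
    simp only [Submodule.coe_add, Subalgebra.coe_add, map_add, coeff_ofCoeff]
    split_ifs <;> simp
  map_smul' c f := by
    refine Subtype.ext (Subtype.ext (ext_coeff fun S a => ?_))
    simp only [Submodule.coe_smul, Subalgebra.coe_smul, map_smul, coeff_ofCoeff, RingHom.id_apply]
    split_ifs <;> simp

theorem coeff_component (m : ℕ) (f : sQSym) (S : Finset ℕ) (a : ℕ →₀ ℕ) :
    coeff S a ((component m f : sQSym) : SuperSeries ℕ) =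
      if S.card = m then coeff S a (f : SuperSeries ℕ) else 0 := rfl

theorem component_of_mem {m n : ℕ} (f : sQSym) (hf : f ∈ fermionic n) :
    (component m f : sQSym) = if m = n then f else 0 := by
  refine Subtype.ext (ext_coeff fun S a => ?_)
  rw [coeff_component]
  by_cases h0 : coeff S a (f : SuperSeries ℕ) = 0
  · by_cases h : m = n <;> simp [h, h0]
  · rw [hf S a h0]
    by_cases h : m = n
    · simp [h]
    · simp [h, Ne.symm h]

theorem sum_component (f : sQSym) {d : ℕ}
    (hd : ∀ S a, coeff S a (f : SuperSeries ℕ) ≠ 0 → a.degree + S.card ≤ d) :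
    ∑ m ∈ Finset.range (d + 1), (component m f : sQSym) = f := by
  refine Subtype.ext (ext_coeff fun S a => ?_)
  rw [AddSubmonoidClass.coe_finsetSum, map_sum]
  simp only [coeff_component, Finset.sum_ite_eq, Finset.mem_range]
  split_ifs with h
  · rfl
  · by_contra h0
    have := hd S a (Ne.symm h0)
    omega

theorem fermionic_isInternal : DirectSum.IsInternal fermionic := by
  rw [DirectSum.isInternal_submodule_iff_iSupIndep_and_iSup_eq_top]
  constructor
  · rw [iSupIndep_def]
    intro i
    rw [Submodule.disjoint_def]
    intro f hf hf'
    have h1 : (component i f : sQSym) = f := by rw [component_of_mem f hf, if_pos rfl]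
    have h2 : (⨆ j, ⨆ (_ : j ≠ i), fermionic j) ≤ LinearMap.ker (component i) := by
      refine iSup₂_le fun j hj g hg => ?_
      rw [LinearMap.mem_ker]
      exact Subtype.ext (by rw [component_of_mem g hg, if_neg (Ne.symm hj)]; rfl)
    rw [← h1, LinearMap.mem_ker.1 (h2 hf')]
    rfl
  · rw [eq_top_iff]
    intro f _
    obtain ⟨d, hd⟩ := f.2.1
    rw [← sum_component f hd]
    exact Submodule.sum_mem _ fun m _ => Submodule.mem_iSup_of_mem m (component m f).2

/-- The grading of `sQSym` by the fermionic degree. -/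
noncomputable instance : GradedAlgebra fermionic where
  one_mem := by
    intro S a h
    by_contra hS
    refine h ?_
    rw [Subalgebra.coe_one, coeff_one, if_neg]
    rintro ⟨rfl, _⟩
    exact hS rfl
  mul_mem := by
    intro i j f g hf hg S a h
    obtain ⟨T, U, b, c, h1, h2, h3, -⟩ := exists_of_coeff_mul_ne_zero h
    rw [← h3, hf _ _ h1, hg _ _ h2]
  toDecomposition := fermionic_isInternal.chooseDecomposition

end sQSym

/-- A dotted composition: a list of parts in `{1, 2, …} ∪ {0̇, 1̇, 2̇, …}`, the pair `(n, true)` being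
the dotted part `ṅ` and `(n, false)` the undotted part `n`. -/
structure DottedComposition where
  parts : List (ℕ × Bool)
  zero_notMem : (0, false) ∉ parts

namespace DottedComposition

/-- Concatenation. -/
def append (β γ : DottedComposition) : DottedComposition :=
  ⟨β.parts ++ γ.parts, by simp [β.zero_notMem, γ.zero_notMem]⟩

/-- The dotted composition formed by the first `k` parts. -/
def take (α : DottedComposition) (k : ℕ) : DottedComposition :=
  ⟨α.parts.take k, fun h => α.zero_notMem (List.mem_of_mem_take h)⟩

/-- The dotted composition formed by the parts after the first `k`. -/
def drop (α : DottedComposition) (k : ℕ) : DottedComposition :=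
  ⟨α.parts.drop k, fun h => α.zero_notMem (List.mem_of_mem_drop h)⟩

/-- The dotted composition `(r)`. -/
def single (r : ℕ) (hr : 1 ≤ r) : DottedComposition :=
  ⟨[(r, false)], by simp; omega⟩

/-- The dotted composition `(k̇)`. -/
def singleDot (k : ℕ) : DottedComposition :=
  ⟨[(k, true)], by simp⟩

end DottedComposition

namespace sQSym

/-- The monomial quasisymmetric function in superspace `M_α`. -/
noncomputable def M (α : DottedComposition) : sQSym :=
  ⟨ofCoeff fun S a => if shape S a = α.parts then 1 else 0, by
    refine ⟨⟨(α.parts.map Prod.fst).sum + (α.parts.map fun p => if p.2 then 1 else 0).sum,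
      fun S a h => ?_⟩, fun S a S' a' h => ?_⟩
    · rw [coeff_ofCoeff] at h
      have hs : shape S a = α.parts := by
        by_contra hs
        exact h (if_neg hs)
      rw [← hs, shape_card, shape_degree]
    · rw [coeff_ofCoeff, coeff_ofCoeff, h]⟩

/-- The power series `f(z; ζ)` obtained by evaluating `f` at an arbitrary linearly ordered alphabet
`z_j, ζ_j`, `j ∈ J`: the coefficient of `ζ_{j₁}^{η₁} ⋯ ζ_{jₗ}^{ηₗ} z_{j₁}^{α₁} ⋯ z_{jₗ}^{αₗ}` with
`j₁ < ⋯ < jₗ` is the coefficient in `f` of the leading monomial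
`θ_0^{η₁} ⋯ θ_{l-1}^{ηₗ} x_0^{α₁} ⋯ x_{l-1}^{αₗ}`. -/
noncomputable def eval (J : Type) [LinearOrder J] (f : sQSym) : SuperSeries J :=
  ofCoeff fun S a =>
    coeff ((Finset.range (shape S a).length).filter fun k =>
        ((shape S a).getD k (0, false)).2 = true)
      (∑ k ∈ Finset.range (shape S a).length,
        Finsupp.single k ((shape S a).getD k (0, false)).1)
      (f : SuperSeries ℕ)

end sQSym

open Classical in
/-- Rename the variables `x_i, θ_i` to `x_{e i}, θ_{e i}`, where `e` is strictly increasing. -/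
noncomputable def SuperSeries.rename {I J : Type} [LinearOrder I] [LinearOrder J] (e : I ↪o J) :
    SuperSeries I →ₗ[ℚ] SuperSeries J where
  toFun f := ofCoeff fun S a =>
    if (S : Set J) ⊆ Set.range e ∧ (a.support : Set J) ⊆ Set.range e then
      coeff (S.preimage e e.injective.injOn) (a.comapDomain e e.injective.injOn) f
    else 0
  map_add' f g := by
    refine ext_coeff fun S a => ?_
    simp only [map_add, coeff_ofCoeff]
    split_ifs <;> simp
  map_smul' c f := by
    refine ext_coeff fun S a => ?_
    simp only [map_smul, coeff_ofCoeff, RingHom.id_apply]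
    split_ifs <;> simp

namespace sQSym

/-- The linear map `f ⊗ g ↦ f(x; θ) g(y; φ)` into the power series in two alphabets
`x_0 < x_1 < ⋯ < y_0 < y_1 < ⋯` and `θ_0 < θ_1 < ⋯ < φ_0 < φ_1 < ⋯` (all of the `θ_i` and `φ_i`
anticommute): `x_i, θ_i` are the variables indexed by the left summand of `ℕ ⊕ₗ ℕ`, and `y_i, φ_i`
those indexed by the right one. -/
noncomputable def twoAlphabets : sQSym ⊗[ℚ] sQSym →ₗ[ℚ] SuperSeries (ℕ ⊕ₗ ℕ) :=
  LinearMap.mul' ℚ (SuperSeries (ℕ ⊕ₗ ℕ)) ∘ₗ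
    TensorProduct.map
      (SuperSeries.rename (OrderEmbedding.ofStrictMono (fun i : ℕ => (Sum.inlₗ i : ℕ ⊕ₗ ℕ))
        fun _ _ h => Sum.Lex.inl_strictMono h) ∘ₗ sQSym.val.toLinearMap)
      (SuperSeries.rename (OrderEmbedding.ofStrictMono (fun i : ℕ => (Sum.inrₗ i : ℕ ⊕ₗ ℕ))
        fun _ _ h => Sum.Lex.inr_strictMono h) ∘ₗ sQSym.val.toLinearMap)

end sQSym

/-- A superpartition `(Λᵃ; Λˢ)`: a partition `Λᵃ` with distinct parts in `{0, 1, 2, …}` and a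
partition `Λˢ` (with its zero parts left out). -/
structure Superpartition where
  anti : Finset ℕ
  sym : Multiset ℕ
  zero_notMem : 0 ∉ sym

/-- The monomial symmetric function in superspace `m_Λ` in the variables `x_i, θ_i`, `i ∈ I`: the
sum of the distinct terms `θ_{i₁} ⋯ θ_{iₘ} x_{i₁}^{Λ₁} ⋯ x_{i_N}^{Λ_N}` with `i₁, …, i_N` distinct,
where `Λᵃ = (Λ₁ > ⋯ > Λₘ)` and `Λˢ = (Λ_{m+1}, …, Λ_N)`. As `Λᵃ` has distinct parts, at most one of
these terms is a multiple of a given `θ_S x^a`; it is `± θ_S x^a`, the sign being that of the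
permutation which sorts `i₁, …, iₘ`, that is, minus one to the number of pairs `i < j` in `S`
with `a i < a j`. -/
noncomputable def monomialSymmetric (I : Type) [LinearOrder I] (Λ : Superpartition) :
    SuperSeries I :=
  ofCoeff fun S a =>
    if S.val.map a = Λ.anti.val ∧ (a.support \ S).val.map a = Λ.sym then
      (-1) ^ ((S ×ˢ S).filter fun p => p.1 < p.2 ∧ a p.1 < a p.2).card
    else 0

/-- The space `Λ` of symmetric functions in superspace, in infinitely many variables. -/
noncomputable def symmetricSuper : Submodule ℚ (SuperSeries ℕ) :=
  Submodule.span ℚ (Set.range (monomialSymmetric ℕ))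

open Classical in
/-- The power sum `p_r = ∑_i x_i^r`, for `r ≥ 1`. -/
noncomputable def powerSum (r : ℕ) : SuperSeries ℕ :=
  ofCoeff fun S a => if S = ∅ ∧ ∃ i, a = Finsupp.single i r then 1 else 0

open Classical in
/-- The power sum `p̃_k = ∑_i θ_i x_i^k`, for `k ≥ 0`. -/
noncomputable def powerSumTilde (k : ℕ) : SuperSeries ℕ :=
  ofCoeff fun S a => if ∃ i, S = {i} ∧ a = Finsupp.single i k then 1 else 0

/-- The algebra `A`, graded by `𝒜` (here by the fermionic degree), with its coalgebra structure and
the antipode `S`, is a Hopf algebra in the graded sense: the product of `A ⊗ A` is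
`(a ⊗ b)(a' ⊗ b') = (-1)^{deg b deg a'} a a' ⊗ b b'`. Coassociativity and the counit laws are part
of `Coalgebra K A`. -/
structure IsSuperHopfAlgebra {K A : Type} [Field K] [Ring A] [Algebra K A]
    (𝒜 : ℕ → Submodule K A) [GradedAlgebra 𝒜] [Coalgebra K A] (S : A →ₗ[K] A) : Prop where
  comul_one : Coalgebra.comul (R := K) (1 : A) = 1 ⊗ₜ[K] 1
  comul_mul : ∀ x y : A,
    GradedTensorProduct.of K 𝒜 𝒜 (Coalgebra.comul (R := K) (x * y)) =
      GradedTensorProduct.of K 𝒜 𝒜 (Coalgebra.comul (R := K) x) *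
        GradedTensorProduct.of K 𝒜 𝒜 (Coalgebra.comul (R := K) y)
  counit_one : Coalgebra.counit (R := K) (1 : A) = 1
  counit_mul : ∀ x y : A, Coalgebra.counit (R := K) (x * y) =
    Coalgebra.counit (R := K) x * Coalgebra.counit (R := K) y
  comul_mem : ∀ n, ∀ x ∈ 𝒜 n, Coalgebra.comul (R := K) x ∈
    ⨆ p ∈ Finset.HasAntidiagonal.antidiagonal n,
      LinearMap.range (TensorProduct.mapIncl (𝒜 p.1) (𝒜 p.2))
  antipode_mem : ∀ n, ∀ x ∈ 𝒜 n, S x ∈ 𝒜 n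
  antipode_left : LinearMap.mul' K A ∘ₗ S.rTensor A ∘ₗ Coalgebra.comul =
    Algebra.linearMap K A ∘ₗ Coalgebra.counit
  antipode_right : LinearMap.mul' K A ∘ₗ S.lTensor A ∘ₗ Coalgebra.comul =
    Algebra.linearMap K A ∘ₗ Coalgebra.counit

/-- `fg = (-1)^{ab} gf` for `f` of degree `a` and `g` of degree `b`. -/
def IsSuperCommutative {K A : Type} [Field K] [Ring A] [Algebra K A]
    (𝒜 : ℕ → Submodule K A) : Prop :=
  ∀ a b, ∀ f ∈ 𝒜 a, ∀ g ∈ 𝒜 b, f * g = (-1) ^ (a * b) * (g * f)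

/-- The subspaces `G n` make the algebra and coalgebra `A` graded and connected. -/
structure IsGradedConnected {K A : Type} [Field K] [Ring A] [Algebra K A]
    (G : ℕ → Submodule K A) [Coalgebra K A] : Prop where
  isInternal : DirectSum.IsInternal G
  gradedMonoid : SetLike.GradedMonoid G
  comul_mem : ∀ n, ∀ x ∈ G n, Coalgebra.comul (R := K) x ∈
    ⨆ p ∈ Finset.HasAntidiagonal.antidiagonal n,
      LinearMap.range (TensorProduct.mapIncl (G p.1) (G p.2))
  finrank_zero : Module.finrank K (G 0) = 1

/-- The subalgebra `L` is a Hopf subalgebra: it is graded, and stable under the coproduct and the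
antipode. -/
structure IsSuperHopfSubalgebra {K A : Type} [Field K] [Ring A] [Algebra K A]
    (𝒜 : ℕ → Submodule K A) [GradedAlgebra 𝒜] [Coalgebra K A] (S : A →ₗ[K] A)
    (L : Subalgebra K A) : Prop where
  decompose_mem : ∀ x ∈ L, ∀ n, (DirectSum.decompose 𝒜 x n : A) ∈ L
  comul_mem : ∀ x ∈ L, Coalgebra.comul (R := K) x ∈
    LinearMap.range (TensorProduct.mapIncl (Subalgebra.toSubmodule L) (Subalgebra.toSubmodule L))
  antipode_mem : ∀ x ∈ L, S x ∈ L

/-! ### Leading monomials of dotted compositions -/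

namespace SuperSeries

variable {I J : Type} [LinearOrder I] [LinearOrder J]

/-! A quasisymmetric series is determined by its coefficients at leading monomials, those whose
indices are exactly `0, …, l - 1`. There is one such monomial for each dotted composition, and
bounded degree leaves finitely many nonzero coefficients, so the `M α` form a basis (`basisM`).

A monomial involves finitely many variables, so identities between series in any ordered alphabet
can be tested after restriction to `Fin l`. There the evaluation of `f` looks like `f` in its first
`l` variables (`restrict_eval`); hence evaluation at any alphabet is an algebra homomorphism
(`evalHom`). In the ordered union of two alphabets, a monomial factors uniquely into a monomial in
each, without sign, and its shape is the concatenation of the two shapes (`coeff_join_mul`,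
`shape_join`). This makes `twoAlphabets` injective and identifies evaluation at the union with
deconcatenation. Coassociativity and the counit laws are then checked on the basis. Multiplicativity
of the coproduct follows because `twoAlphabets` is an injective homomorphism for the signed product
and evaluation is multiplicative.

Connectedness makes the antipode recursive: a left convolution inverse is obtained by solving for
the last term of the coproduct. The same construction applied to that inverse shows that it is
two-sided (`convInv_mul`, `antipode_right`).

Symmetric functions are characterized by invariance under pullback along all injections of finite
alphabets, pullback carrying the sign that sorts the `θ`'s. Pullback is multiplicative
(`invSign_union`), so the invariants form a subalgebra. They are spanned by the `m_Λ`: swapping two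
`θ`'s with equal exponents kills a coefficient, and all other coefficients are fixed by one for each
superpartition. The coproduct of `m_Λ` distributes the parts of `Λ` over the two alphabets with a
shuffle sign (`comul_m`); the antipode identity and induction on the number of parts then give
stability under the antipode. -/

theorem zero_notMem_shape (S : Finset I) (a : I →₀ ℕ) : (0, false) ∉ shape S a := by
  simp only [shape, List.mem_map, Finset.mem_sort, Finset.mem_union, Finsupp.mem_support_iff,
    Prod.mk.injEq, decide_eq_false_iff_not, not_exists, not_and, not_not]
  tauto

/-- The dotted composition of the monomial `θ_S x^a`. -/
def composition (S : Finset I) (a : I →₀ ℕ) : DottedComposition :=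
  ⟨shape S a, zero_notMem_shape S a⟩

/-- The set of indices of the variables `θ` in the leading monomial of shape `L`. -/
def leadSet (L : List (ℕ × Bool)) : Finset ℕ :=
  (Finset.range L.length).filter fun k => (L.getD k (0, false)).2 = true

/-- The exponents of the variables `x` in the leading monomial of shape `L`. -/
noncomputable def leadExp (L : List (ℕ × Bool)) : ℕ →₀ ℕ :=
  ∑ k ∈ Finset.range L.length, Finsupp.single k (L.getD k (0, false)).1

theorem leadExp_apply (L : List (ℕ × Bool)) (i : ℕ) :
    leadExp L i = (L.getD i (0, false)).1 := by
  rw [leadExp, Finsupp.finsetSum_apply]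
  simp only [Finsupp.single_apply, Finset.sum_ite_eq', Finset.mem_range]
  split_ifs with h
  · rfl
  · rw [List.getD_eq_default _ _ (not_lt.1 h)]

theorem mem_leadSet {L : List (ℕ × Bool)} {i : ℕ} :
    i ∈ leadSet L ↔ (L.getD i (0, false)).2 = true := by
  simp only [leadSet, Finset.mem_filter, Finset.mem_range, and_iff_right_iff_imp]
  intro h
  by_contra hi
  rw [List.getD_eq_default _ _ (not_lt.1 hi)] at h
  simp at h

/-- A part other than `(0, false)` has a positive exponent or a dot, so each position below the
length really occurs in the monomial and no gap shifts the later parts. -/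
theorem shape_lead {L : List (ℕ × Bool)} (h : (0, false) ∉ L) :
    shape (leadSet L) (leadExp L) = L := by
  have hs : (leadExp L).support ∪ leadSet L = Finset.range L.length := by
    ext i
    simp only [Finset.mem_union, Finsupp.mem_support_iff, leadExp_apply, mem_leadSet,
      Finset.mem_range]
    constructor
    · intro hi
      by_contra hl
      rw [List.getD_eq_default _ _ (not_lt.1 hl)] at hi
      simp at hi
    · intro hi
      rw [List.getD_eq_getElem _ _ hi]
      have := List.getElem_mem hi
      rcases hL : L[i] with ⟨n, b⟩
      rw [hL] at this
      rcases n with - | n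
      · cases b
        · exact absurd this h
        · simp
      · simp
  rw [shape, hs, Finset.sort_range]
  refine List.ext_getElem (by simp) fun i h1 h2 => ?_
  simp [leadExp_apply, mem_leadSet, List.getElem?_eq_getElem h2]

/-- Every monomial is the image of a monomial in finitely many variables, all of them present. -/
theorem exists_eq_map (S : Finset I) (a : I →₀ ℕ) :
    ∃ (l : ℕ) (e : Fin l ↪o I) (T : Finset (Fin l)) (b : Fin l →₀ ℕ),
      S = T.map e.toEmbedding ∧ a = b.embDomain e.toEmbedding := by
  obtain ⟨l, e, -, T, b, h, h', -⟩ := exists_of_shape_eq (rfl : shape S a = shape S a)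
  exact ⟨l, e, T, b, h, h'⟩

end SuperSeries

/-! ### Finiteness in bounded degree and the monomial basis -/

namespace DottedComposition

theorem ext {α β : DottedComposition} (h : α.parts = β.parts) : α = β := by
  cases α; cases β; cases h; rfl

instance : DecidableEq DottedComposition := fun α β =>
  decidable_of_iff (α.parts = β.parts) ⟨ext, fun h => h ▸ rfl⟩

/-- The degree in the variables `x` of `M_α`. -/
def degree (α : DottedComposition) : ℕ := (α.parts.map Prod.fst).sum

/-- The number of dotted parts. -/
def dots (α : DottedComposition) : ℕ := (α.parts.map fun p => if p.2 then 1 else 0).sum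

/-- Each part contributes at least one to the degree plus the number of dots. So `d` bounds the
length as well as every entry, and only finitely many lists remain. -/
theorem finite_degree_add_dots_le (d : ℕ) :
    {α : DottedComposition | α.degree + α.dots ≤ d}.Finite := by
  have hf := (List.finite_length_le (Fin (d + 1) × Bool) d).image
    (List.map fun p => ((p.1 : ℕ), p.2))
  refine Set.Finite.of_injOn (f := DottedComposition.parts) ?_ (fun α _ β _ h => ext h) hf
  intro α hα
  have key : ∀ L : List (ℕ × Bool), (0, false) ∉ L →
      L.length ≤ (L.map Prod.fst).sum + (L.map fun p => if p.2 then 1 else 0).sum ∧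
      ∀ p ∈ L, p.1 ≤ (L.map Prod.fst).sum := by
    intro L hL
    refine ⟨?_, fun p hp => List.le_sum_of_mem (List.mem_map_of_mem hp)⟩
    induction L with
    | nil => simp
    | cons p L ih =>
      have := ih fun h => hL (List.mem_cons_of_mem _ h)
      have hp : 1 ≤ p.1 + if p.2 then 1 else 0 := by
        rcases p with ⟨- | n, - | -⟩
        · simp at hL
        · simp
        · simp
        · simp
      simp only [List.length_cons, List.map_cons, List.sum_cons]
      omega
  obtain ⟨h1, h2⟩ := key _ α.zero_notMem
  have hd : (α.parts.map Prod.fst).sum + (α.parts.map fun p => if p.2 then 1 else 0).sum ≤ d := hα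
  -- `Fin.ofNat` reduces modulo `d + 1`, which changes nothing because all entries are at most `d`.
  refine ⟨α.parts.map fun p => (Fin.ofNat (d + 1) p.1, p.2), ?_, ?_⟩
  · simpa using h1.trans hd
  · rw [List.map_map]
    conv_rhs => rw [← List.map_id α.parts]
    refine List.map_congr_left fun p hp => ?_
    have := h2 p hp
    have hlt : p.1 < d + 1 := by omega
    simp [Nat.mod_eq_of_lt hlt]

end DottedComposition

namespace sQSym

/-- The coefficient of `M_α`. -/
noncomputable def coef (α : DottedComposition) : sQSym →ₗ[ℚ] ℚ :=
  coeff (leadSet α.parts) (leadExp α.parts) ∘ₗ sQSym.val.toLinearMap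

theorem coef_apply (α : DottedComposition) (f : sQSym) :
    coef α f = coeff (leadSet α.parts) (leadExp α.parts) (f : SuperSeries ℕ) := rfl

/-- Quasisymmetry moves any monomial to the leading monomial of the same shape. -/
theorem coeff_eq_coef (f : sQSym) (S : Finset ℕ) (a : ℕ →₀ ℕ) :
    coeff S a (f : SuperSeries ℕ) = coef (composition S a) f :=
  f.2.2 _ _ _ _ (shape_lead (zero_notMem_shape S a)).symm

theorem ext_coef {f g : sQSym} (h : ∀ α, coef α f = coef α g) : f = g :=
  Subtype.ext (ext_coeff fun S a => by rw [coeff_eq_coef, coeff_eq_coef, h])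

theorem coeff_M (α : DottedComposition) (S : Finset ℕ) (a : ℕ →₀ ℕ) :
    coeff S a (M α : SuperSeries ℕ) = if shape S a = α.parts then 1 else 0 := rfl

theorem coef_M (α β : DottedComposition) : coef β (M α) = if α = β then 1 else 0 := by
  rw [coef_apply, coeff_M, shape_lead β.zero_notMem]
  by_cases h : α = β
  · simp [h]
  · rw [if_neg h, if_neg fun h' => h (DottedComposition.ext h'.symm)]

theorem card_leadSet (α : DottedComposition) : (leadSet α.parts).card = α.dots := by
  rw [← shape_card _ (leadExp α.parts), shape_lead α.zero_notMem]; rfl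

theorem degree_leadExp (α : DottedComposition) : (leadExp α.parts).degree = α.degree := by
  rw [← shape_degree (leadSet α.parts), shape_lead α.zero_notMem]; rfl

theorem finite_coef_ne_zero (f : sQSym) : {α | coef α f ≠ 0}.Finite := by
  obtain ⟨d, hd⟩ := f.2.1
  refine (DottedComposition.finite_degree_add_dots_le d).subset fun α h => ?_
  have := hd _ _ h
  rwa [card_leadSet, degree_leadExp] at this

/-- The coefficients of `f` in the basis `M`. -/
noncomputable def coefs (f : sQSym) : DottedComposition →₀ ℚ :=
  Finsupp.ofSupportFinite (fun α => coef α f) (finite_coef_ne_zero f)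

theorem coefs_apply (f : sQSym) (α : DottedComposition) : coefs f α = coef α f := rfl

theorem sum_coef_smul_M (f : sQSym) :
    ∑ α ∈ (coefs f).support, coef α f • M α = f :=
  ext_coef fun β => by
    rw [map_sum]
    simp only [map_smul, coef_M, smul_eq_mul, mul_ite, mul_one, mul_zero, Finset.sum_ite_eq',
      Finsupp.mem_support_iff, coefs_apply]
    split_ifs with h
    · rfl
    · exact (not_not.1 h).symm

/-- The basis of the monomial quasisymmetric functions in superspace. -/
noncomputable def basisM : Module.Basis DottedComposition ℚ sQSym :=
  .ofRepr
    { toFun := coefs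
      map_add' f g := by ext α; simp [coefs_apply]
      map_smul' c f := by ext α; simp [coefs_apply]
      invFun := Finsupp.linearCombination ℚ M
      left_inv f := sum_coef_smul_M f
      right_inv c := by
        ext β
        rw [coefs_apply, Finsupp.linearCombination_apply, Finsupp.sum, map_sum]
        simp only [map_smul, coef_M, smul_eq_mul, mul_ite, mul_one, mul_zero,
          Finset.sum_ite_eq', Finsupp.mem_support_iff]
        split_ifs with h
        · rfl
        · exact (not_not.1 h).symm }

theorem basisM_repr (f : sQSym) (α : DottedComposition) : basisM.repr f α = coef α f := rfl

theorem basisM_apply (α : DottedComposition) : basisM α = M α := by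
  rw [Module.Basis.apply_eq_iff]
  ext β
  rw [basisM_repr, coef_M, Finsupp.single_apply]

theorem linearMap_ext {V : Type} [AddCommGroup V] [Module ℚ V] {φ ψ : sQSym →ₗ[ℚ] V}
    (h : ∀ α, φ (M α) = ψ (M α)) : φ = ψ :=
  basisM.ext fun α => by rw [basisM_apply, h]

end sQSym

/-! ### Renaming of variables and the sign rule for commuting series -/

namespace SuperSeries

variable {I J : Type} [LinearOrder I] [LinearOrder J]

theorem restrict_one (e : J ↪o I) : restrict e (1 : SuperSeries I) = 1 :=
  ext_coeff fun S a => by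
    rw [coeff_restrict, coeff_one, coeff_one]
    simp only [Finset.map_eq_empty, Finsupp.embDomain_eq_zero]

theorem coeff_rename_map (e : I ↪o J) (f : SuperSeries I) (S : Finset I) (a : I →₀ ℕ) :
    coeff (S.map e.toEmbedding) (a.embDomain e.toEmbedding) (rename e f) = coeff S a f := by
  classical
  have h : coeff (S.map e.toEmbedding) (a.embDomain e.toEmbedding) (rename e f) =
    if ((S.map e.toEmbedding : Finset J) : Set J) ⊆ Set.range e ∧
        ((a.embDomain e.toEmbedding).support : Set J) ⊆ Set.range e then
      coeff ((S.map e.toEmbedding).preimage e e.injective.injOn)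
        ((a.embDomain e.toEmbedding).comapDomain e e.injective.injOn) f
    else 0 := by rw [rename]; simp only [LinearMap.coe_mk, AddHom.coe_mk, coeff_ofCoeff]
  rw [h, if_pos]
  · congr 1
    congr 1
    · ext i; simp
    · ext i
      exact Finsupp.embDomain_apply_self e.toEmbedding a i
  · constructor
    · intro j; simp
      rintro x _ rfl; exact ⟨x, rfl⟩
    · rw [Finsupp.support_embDomain]
      intro j; simp
      rintro x _ rfl; exact ⟨x, rfl⟩

theorem exists_eq_map_of_coeff_rename_ne_zero {e : I ↪o J} {f : SuperSeries I} {S : Finset J}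
    {a : J →₀ ℕ} (h : coeff S a (rename e f) ≠ 0) :
    ∃ (T : Finset I) (b : I →₀ ℕ),
      S = T.map e.toEmbedding ∧ a = b.embDomain e.toEmbedding := by
  classical
  have h' : (S : Set J) ⊆ Set.range e ∧ (a.support : Set J) ⊆ Set.range e := by
    by_contra h0
    refine h ?_
    rw [rename]
    simp only [LinearMap.coe_mk, AddHom.coe_mk, coeff_ofCoeff, if_neg h0]
  refine ⟨S.preimage e e.injective.injOn, a.comapDomain e e.injective.injOn, ?_,
    (Finsupp.embDomain_comapDomain (f := e.toEmbedding) h'.2).symm⟩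
  ext j
  simp only [Finset.mem_map, Finset.mem_preimage]
  constructor
  · intro hj
    obtain ⟨i, rfl⟩ := h'.1 hj
    exact ⟨i, hj, rfl⟩
  · rintro ⟨i, hi, rfl⟩
    exact hi

theorem restrict_rename (e : I ↪o J) (f : SuperSeries I) : restrict e (rename e f) = f :=
  ext_coeff fun S a => by rw [coeff_restrict, coeff_rename_map]

/-- On monomials in the image of `e`, apply `restrict`, which is multiplicative and undoes `rename`.
Elsewhere both sides vanish, because a product of two monomials from the image lies in the image. -/
theorem rename_mul (e : I ↪o J) (f g : SuperSeries I) :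
    rename e (f * g) = rename e f * rename e g := by
  refine ext_coeff fun S a => ?_
  by_cases h : ∃ (T : Finset I) (b : I →₀ ℕ),
      S = T.map e.toEmbedding ∧ a = b.embDomain e.toEmbedding
  · obtain ⟨T, b, rfl, rfl⟩ := h
    rw [← coeff_restrict, ← coeff_restrict, restrict_mul, restrict_rename, restrict_rename,
      restrict_rename]
  · have h1 : coeff S a (rename e (f * g)) = 0 := by
      by_contra h0
      exact h (exists_eq_map_of_coeff_rename_ne_zero h0)
    rw [h1, coeff_mul]
    symm
    refine Finset.sum_eq_zero fun T hT => Finset.sum_eq_zero fun p hp => ?_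
    by_contra h0
    obtain ⟨T', b, hT', hb⟩ := exists_eq_map_of_coeff_rename_ne_zero
      (left_ne_zero_of_mul (right_ne_zero_of_mul h0))
    obtain ⟨U', c, hU', hc⟩ := exists_eq_map_of_coeff_rename_ne_zero
      (right_ne_zero_of_mul (right_ne_zero_of_mul h0))
    refine h ⟨T' ∪ U', b + c, ?_, ?_⟩
    · rw [Finset.map_union, ← hT', ← hU', Finset.union_sdiff_of_subset (Finset.mem_powerset.1 hT)]
    · rw [Finsupp.embDomain_add, ← hb, ← hc, Finset.HasAntidiagonal.mem_antidiagonal.1 hp]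

theorem rename_one (e : I ↪o J) : rename e (1 : SuperSeries I) = 1 := by
  refine ext_coeff fun S a => ?_
  by_cases h : ∃ (T : Finset I) (b : I →₀ ℕ),
      S = T.map e.toEmbedding ∧ a = b.embDomain e.toEmbedding
  · obtain ⟨T, b, rfl, rfl⟩ := h
    rw [← coeff_restrict, ← coeff_restrict, restrict_rename, restrict_one]
  · have h1 : coeff S a (rename e (1 : SuperSeries I)) = 0 := by
      by_contra h0
      exact h (exists_eq_map_of_coeff_rename_ne_zero h0)
    rw [h1, coeff_one, if_neg]
    rintro ⟨rfl, rfl⟩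
    exact h ⟨∅, 0, by simp⟩

/-- The homomorphism that renames the variables. -/
noncomputable def renameHom (e : I ↪o J) : SuperSeries I →ₐ[ℚ] SuperSeries J :=
  AlgHom.ofLinearMap (rename e) (rename_one e) (rename_mul e)

/-- Each pair in `T ×ˢ U` is an inversion for exactly one of the two orders of the factors, so the
two inversion counts add up to `T.card * U.card`. Disjointness excludes equal entries. -/
theorem sgn_comm {T U : Finset I} (h : Disjoint T U) :
    sgn T U = (-1) ^ (T.card * U.card) * sgn U T := by
  have h1 : ((T ×ˢ U).filter fun p => p.2 < p.1).card +
      ((U ×ˢ T).filter fun p => p.2 < p.1).card = T.card * U.card := by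
    have h2 : ((U ×ˢ T).filter fun p => p.2 < p.1).card =
        ((T ×ˢ U).filter fun p => ¬ p.2 < p.1).card := by
      refine Finset.card_bij' (fun p _ => p.swap) (fun p _ => p.swap) ?_ ?_ ?_ ?_
      · rintro ⟨x, y⟩
        simp only [Finset.mem_filter, Finset.mem_product, Prod.swap_prod_mk, and_imp]
        exact fun hx hy hxy => ⟨⟨hy, hx⟩, hxy.not_gt⟩
      · rintro ⟨x, y⟩
        simp only [Finset.mem_filter, Finset.mem_product, Prod.swap_prod_mk, and_imp]
        refine fun hx hy hxy => ⟨⟨hy, hx⟩, lt_of_le_of_ne (not_lt.1 hxy) ?_⟩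
        rintro rfl
        exact Finset.disjoint_left.1 h hx hy
      · intros; rfl
      · intros; rfl
    rw [h2, Finset.card_filter_add_card_filter_not, Finset.card_product]
  rw [sgn, sgn, ← h1, pow_add, mul_assoc, ← pow_add, ← two_mul, pow_mul]
  simp

/-- Series of fermionic degrees `m` and `n` commute up to the sign `(-1)^{mn}`. -/
theorem mul_comm_of_card {f g : SuperSeries I} {m n : ℕ} (hf : ∀ S a, coeff S a f ≠ 0 → S.card = m)
    (hg : ∀ S a, coeff S a g ≠ 0 → S.card = n) : f * g = (-1 : ℚ) ^ (m * n) • (g * f) := by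
  refine ext_coeff fun S a => ?_
  rw [map_smul, coeff_mul, coeff_mul, smul_eq_mul, Finset.mul_sum]
  refine Finset.sum_bij' (fun T _ => S \ T) (fun T _ => S \ T) ?_ ?_ ?_ ?_ ?_
  · simp
  · simp
  · intro T hT; simpa using hT
  · intro T hT; simpa using hT
  · intro T hT
    rw [Finset.mem_powerset] at hT
    rw [Finset.mul_sum]
    refine Finset.sum_equiv (Equiv.prodComm _ _)
      (fun p => Finset.HasAntidiagonal.swap_mem_antidiagonal.symm) fun p _ => ?_
    simp only [Equiv.prodComm_apply, Prod.fst_swap, Prod.snd_swap, Finset.sdiff_sdiff_eq_self hT]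
    by_cases h1 : coeff T p.1 f = 0
    · simp [h1]
    by_cases h2 : coeff (S \ T) p.2 g = 0
    · simp [h2]
    rw [sgn_comm Finset.disjoint_sdiff, hf _ _ h1, hg _ _ h2]
    ring

end SuperSeries

/-! ### Evaluation at an arbitrary ordered alphabet -/

namespace sQSym

theorem coeff_eval (J : Type) [LinearOrder J] (f : sQSym) (S : Finset J) (a : J →₀ ℕ) :
    coeff S a (eval J f) = coef (composition S a) f := rfl

/-- Both sides read the coefficient of `f` belonging to a shape, and order embeddings preserve
shapes. Thus products in an arbitrary alphabet can be compared with products in the original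
variables. -/
theorem restrict_eval {J : Type} [LinearOrder J] {l : ℕ} (e : Fin l ↪o J) (f : sQSym) :
    restrict e (eval J f) = restrict (Fin.valOrderEmb l) (f : SuperSeries ℕ) :=
  ext_coeff fun S a => by
    rw [coeff_restrict, coeff_restrict, coeff_eval, coeff_eq_coef, composition, composition]
    congr 1
    exact congrArg coef (DottedComposition.ext
      ((shape_map e S a).trans (shape_map (Fin.valOrderEmb l) S a).symm))

/-- Evaluation at an arbitrary alphabet is a homomorphism. -/
noncomputable def evalHom (J : Type) [LinearOrder J] : sQSym →ₐ[ℚ] SuperSeries J :=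
  AlgHom.ofLinearMap
    { toFun := eval J
      map_add' f g := ext_coeff fun S a => by simp only [map_add, coeff_eval]
      map_smul' c f := ext_coeff fun S a => by simp only [map_smul, coeff_eval, RingHom.id_apply] }
    (ext_coeff fun S a => by
      obtain ⟨l, e, T, b, rfl, rfl⟩ := exists_eq_map S a
      rw [← coeff_restrict, ← coeff_restrict]
      change coeff T b (restrict e (eval J 1)) = _
      rw [restrict_eval, Subalgebra.coe_one, restrict_one, restrict_one])
    (fun f g => ext_coeff fun S a => by
      -- The monomial lives in `l` variables, so it suffices to compare the restrictions to these,
      -- and restriction is multiplicative.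
      obtain ⟨l, e, T, b, rfl, rfl⟩ := exists_eq_map S a
      rw [← coeff_restrict, ← coeff_restrict, restrict_mul]
      change coeff T b (restrict e (eval J (f * g))) =
        coeff T b (restrict e (eval J f) * restrict e (eval J g))
      rw [restrict_eval, restrict_eval, restrict_eval, Subalgebra.coe_mul, restrict_mul])

theorem evalHom_apply (J : Type) [LinearOrder J] (f : sQSym) : evalHom J f = eval J f := rfl

end sQSym

/-! ### Monomials in the ordered union of two alphabets -/

namespace SuperSeries

/-- The inclusion of the first alphabet. -/
def inlEmb : ℕ ↪o ℕ ⊕ₗ ℕ :=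
  OrderEmbedding.ofStrictMono (fun i : ℕ => (Sum.inlₗ i : ℕ ⊕ₗ ℕ))
    fun _ _ h => Sum.Lex.inl_strictMono h

/-- The inclusion of the second alphabet. -/
def inrEmb : ℕ ↪o ℕ ⊕ₗ ℕ :=
  OrderEmbedding.ofStrictMono (fun i : ℕ => (Sum.inrₗ i : ℕ ⊕ₗ ℕ))
    fun _ _ h => Sum.Lex.inr_strictMono h

/-- The alphabet `K` is the ordered union of the images of `u` and `v`. -/
structure IsOrderedUnion {K : Type} [LinearOrder K] (u v : ℕ ↪o K) : Prop where
  lt : ∀ i j, u i < v j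
  cover : ∀ x, (∃ i, x = u i) ∨ ∃ i, x = v i

theorem isOrderedUnion_inlEmb_inrEmb : IsOrderedUnion inlEmb inrEmb where
  lt _ _ := Sum.Lex.inl_lt_inr _ _
  cover x := by
    rcases h : ofLex x with i | i
    · exact Or.inl ⟨i, h⟩
    · exact Or.inr ⟨i, h⟩

section Join

variable {K : Type} [LinearOrder K] {u v : ℕ ↪o K}

theorem IsOrderedUnion.ne (h : IsOrderedUnion u v) (i j : ℕ) : u i ≠ v j := (h.lt i j).ne

/-- The union of a set of indices in the first alphabet and one in the second. -/
def joinSet (u v : ℕ ↪o K) (S T : Finset ℕ) : Finset K :=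
  S.map u.toEmbedding ∪ T.map v.toEmbedding

/-- The exponents of a product of monomials in the first and in the second alphabet. -/
noncomputable def joinExp (u v : ℕ ↪o K) (a b : ℕ →₀ ℕ) : K →₀ ℕ :=
  a.embDomain u.toEmbedding + b.embDomain v.toEmbedding

theorem left_mem_joinSet (huv : IsOrderedUnion u v) {S T : Finset ℕ} {i : ℕ} :
    u i ∈ joinSet u v S T ↔ i ∈ S := by
  simp only [joinSet, Finset.mem_union, Finset.mem_map, RelEmbedding.coe_toEmbedding,
    EmbeddingLike.apply_eq_iff_eq, exists_eq_right, or_iff_left_iff_imp, forall_exists_index,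
    and_imp]
  exact fun x _ h => absurd h.symm (huv.ne _ _)

theorem right_mem_joinSet (huv : IsOrderedUnion u v) {S T : Finset ℕ} {i : ℕ} :
    v i ∈ joinSet u v S T ↔ i ∈ T := by
  simp only [joinSet, Finset.mem_union, Finset.mem_map, RelEmbedding.coe_toEmbedding,
    EmbeddingLike.apply_eq_iff_eq, exists_eq_right, or_iff_right_iff_imp, forall_exists_index,
    and_imp]
  exact fun x _ h => absurd h (huv.ne _ _)

theorem embDomain_left_right (huv : IsOrderedUnion u v) (a : ℕ →₀ ℕ) (i : ℕ) :
    a.embDomain u.toEmbedding (v i) = 0 :=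
  Finsupp.embDomain_of_notMem_range _ _ _ (by rintro ⟨x, h⟩; exact huv.ne _ _ h)

theorem embDomain_right_left (huv : IsOrderedUnion u v) (a : ℕ →₀ ℕ) (i : ℕ) :
    a.embDomain v.toEmbedding (u i) = 0 :=
  Finsupp.embDomain_of_notMem_range _ _ _ (by rintro ⟨x, h⟩; exact huv.ne _ _ h.symm)

theorem joinExp_left (huv : IsOrderedUnion u v) (a b : ℕ →₀ ℕ) (i : ℕ) :
    joinExp u v a b (u i) = a i := by
  rw [joinExp, Finsupp.add_apply, embDomain_right_left huv, add_zero]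
  exact Finsupp.embDomain_apply_self u.toEmbedding a i

theorem joinExp_right (huv : IsOrderedUnion u v) (a b : ℕ →₀ ℕ) (i : ℕ) :
    joinExp u v a b (v i) = b i := by
  rw [joinExp, Finsupp.add_apply, embDomain_left_right huv, zero_add]
  exact Finsupp.embDomain_apply_self v.toEmbedding b i

theorem exists_eq_joinSet (huv : IsOrderedUnion u v) (S : Finset K) :
    ∃ T U, S = joinSet u v T U := by
  refine ⟨S.preimage u u.injective.injOn, S.preimage v v.injective.injOn, ?_⟩
  ext x
  rcases huv.cover x with ⟨i, rfl⟩ | ⟨i, rfl⟩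
  · rw [left_mem_joinSet huv, Finset.mem_preimage]
  · rw [right_mem_joinSet huv, Finset.mem_preimage]

theorem exists_eq_joinExp (huv : IsOrderedUnion u v) (a : K →₀ ℕ) :
    ∃ b c, a = joinExp u v b c := by
  refine ⟨a.comapDomain u u.injective.injOn, a.comapDomain v v.injective.injOn,
    ?_⟩
  ext x
  rcases huv.cover x with ⟨i, rfl⟩ | ⟨i, rfl⟩
  · rw [joinExp_left huv, Finsupp.comapDomain_apply]
  · rw [joinExp_right huv, Finsupp.comapDomain_apply]

theorem ext_join (huv : IsOrderedUnion u v) {f g : SuperSeries K}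
    (h : ∀ S T a b, coeff (joinSet u v S T) (joinExp u v a b) f =
      coeff (joinSet u v S T) (joinExp u v a b) g) :
    f = g := by
  refine ext_coeff fun S a => ?_
  obtain ⟨T, U, rfl⟩ := exists_eq_joinSet huv S
  obtain ⟨b, c, rfl⟩ := exists_eq_joinExp huv a
  exact h _ _ _ _

theorem support_joinExp (huv : IsOrderedUnion u v) (a b : ℕ →₀ ℕ) :
    (joinExp u v a b).support = joinSet u v a.support b.support := by
  ext x
  rcases huv.cover x with ⟨i, rfl⟩ | ⟨i, rfl⟩
  · rw [left_mem_joinSet huv, Finsupp.mem_support_iff, Finsupp.mem_support_iff, joinExp_left huv]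
  · rw [right_mem_joinSet huv, Finsupp.mem_support_iff, Finsupp.mem_support_iff, joinExp_right huv]

theorem sort_joinSet (huv : IsOrderedUnion u v) (S T : Finset ℕ) :
    (joinSet u v S T).sort = S.sort.map u ++ T.sort.map v := by
  have hS : (S.sort.map u).toFinset = S.map u.toEmbedding := by
    ext; simp
  have hT : (T.sort.map v).toFinset = T.map v.toEmbedding := by
    ext; simp
  rw [joinSet, ← hS, ← hT, ← List.toFinset_append, List.toFinset_sort]
  · rw [List.pairwise_append]
    refine ⟨?_, ?_, ?_⟩
    · rw [List.pairwise_map]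
      exact (Finset.pairwise_sort S _).imp fun h => u.le_iff_le.2 h
    · rw [List.pairwise_map]
      exact (Finset.pairwise_sort T _).imp fun h => v.le_iff_le.2 h
    · simp only [List.mem_map, forall_exists_index, and_imp]
      rintro _ x _ rfl _ y _ rfl
      exact (huv.lt x y).le
  · rw [List.nodup_append]
    refine ⟨(Finset.sort_nodup S _).map u.injective, (Finset.sort_nodup T _).map v.injective,
      ?_⟩
    simp only [List.mem_map, forall_exists_index, and_imp]
    rintro _ x _ rfl _ y _ rfl
    exact huv.ne x y

theorem joinSet_union (huv : IsOrderedUnion u v) (S T S' T' : Finset ℕ) :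
    joinSet u v S T ∪ joinSet u v S' T' = joinSet u v (S ∪ S') (T ∪ T') := by
  ext x
  rcases huv.cover x with ⟨i, rfl⟩ | ⟨i, rfl⟩
  · simp only [Finset.mem_union, left_mem_joinSet huv]
  · simp only [Finset.mem_union, right_mem_joinSet huv]

/-- Since the first alphabet precedes the second, the increasing list of indices is a concatenation.
This is why the coproduct deconcatenates. -/
theorem shape_join (huv : IsOrderedUnion u v) (S T : Finset ℕ) (a b : ℕ →₀ ℕ) :
    shape (joinSet u v S T) (joinExp u v a b) = shape S a ++ shape T b := by
  rw [shape, support_joinExp huv, joinSet_union huv, sort_joinSet huv, List.map_append,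
    List.map_map, List.map_map, shape, shape]
  congr 1
  · refine List.map_congr_left fun i _ => ?_
    simp [joinExp_left huv, left_mem_joinSet huv]
  · refine List.map_congr_left fun i _ => ?_
    simp [joinExp_right huv, right_mem_joinSet huv]

theorem sgn_left_right (huv : IsOrderedUnion u v) (S T : Finset ℕ) :
    sgn (S.map u.toEmbedding) (T.map v.toEmbedding) = 1 := by
  rw [sgn, Finset.filter_false_of_mem]
  · rfl
  · rintro ⟨x, y⟩ h
    simp only [Finset.mem_product, Finset.mem_map] at h
    obtain ⟨⟨i, -, rfl⟩, ⟨j, -, rfl⟩⟩ := h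
    exact (huv.lt i j).not_gt

/-- Only one factorization of the joined monomial has its first factor in the `u`-variables and its
second in the `v`-variables. Its sign is `1`, as all the `θ`'s of the first factor already come
first. -/
theorem coeff_join_mul (huv : IsOrderedUnion u v) (f g : SuperSeries ℕ) (S T : Finset ℕ)
    (a b : ℕ →₀ ℕ) :
    coeff (joinSet u v S T) (joinExp u v a b) (rename u f * rename v g) =
      coeff S a f * coeff T b g := by
  have hd : joinSet u v S T \ S.map u.toEmbedding = T.map v.toEmbedding := by
    ext x
    simp only [Finset.mem_sdiff]
    rcases huv.cover x with ⟨i, rfl⟩ | ⟨i, rfl⟩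
    · simp only [left_mem_joinSet huv, Finset.mem_map, RelEmbedding.coe_toEmbedding,
        EmbeddingLike.apply_eq_iff_eq, exists_eq_right, and_not_self, false_iff, not_exists,
        not_and]
      exact fun j _ h => huv.ne _ _ h.symm
    · simp only [right_mem_joinSet huv, Finset.mem_map, RelEmbedding.coe_toEmbedding,
        EmbeddingLike.apply_eq_iff_eq, exists_eq_right, and_iff_left_iff_imp, not_exists, not_and]
      exact fun _ j _ h => huv.ne _ _ h
  rw [coeff_mul, Finset.sum_eq_single (S.map u.toEmbedding),
    Finset.sum_eq_single (a.embDomain u.toEmbedding, b.embDomain v.toEmbedding)]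
  · rw [hd, sgn_left_right huv, one_mul, coeff_rename_map, coeff_rename_map]
  · rintro ⟨c, d⟩ hp hne
    by_contra h0
    obtain ⟨_, c, _, rfl⟩ := exists_eq_map_of_coeff_rename_ne_zero
      (left_ne_zero_of_mul (right_ne_zero_of_mul h0))
    obtain ⟨_, d, _, rfl⟩ := exists_eq_map_of_coeff_rename_ne_zero
      (right_ne_zero_of_mul (right_ne_zero_of_mul h0))
    have h : joinExp u v c d = joinExp u v a b := by
      rw [Finset.HasAntidiagonal.mem_antidiagonal] at hp
      rw [← hp, joinExp]
    refine hne ?_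
    congr 2
    · ext i; rw [← joinExp_left huv c d, h, joinExp_left huv]
    · ext i; rw [← joinExp_right huv c d, h, joinExp_right huv]
  · intro h
    refine absurd ?_ h
    rw [Finset.HasAntidiagonal.mem_antidiagonal, joinExp]
  · intro T' hT' hne
    refine Finset.sum_eq_zero fun p hp => ?_
    by_contra h0
    obtain ⟨X, _, hX, -⟩ := exists_eq_map_of_coeff_rename_ne_zero
      (left_ne_zero_of_mul (right_ne_zero_of_mul h0))
    obtain ⟨Y, _, hY, -⟩ := exists_eq_map_of_coeff_rename_ne_zero
      (right_ne_zero_of_mul (right_ne_zero_of_mul h0))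
    have h : joinSet u v X Y = joinSet u v S T := by
      rw [joinSet, ← hX, ← hY, Finset.union_sdiff_of_subset (Finset.mem_powerset.1 hT')]
    refine hne ?_
    rw [hX]
    congr 1
    ext i; rw [← left_mem_joinSet huv (T := Y), h, left_mem_joinSet huv]
  · intro h
    exact absurd (Finset.mem_powerset.2 Finset.subset_union_left) h

end Join

end SuperSeries

/-! ### Deconcatenation and the coalgebra structure -/

namespace DottedComposition

/-- The empty dotted composition. -/
def nil : DottedComposition := ⟨[], by simp⟩

theorem length_take_le {α : DottedComposition} {k : ℕ} (h : k ≤ α.parts.length) :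
    (α.take k).parts.length = k := by
  simp [take, h]

theorem append_take_drop (α : DottedComposition) (k : ℕ) : (α.take k).append (α.drop k) = α :=
  ext (List.take_append_drop k α.parts)

theorem take_zero (α : DottedComposition) : α.take 0 = nil := rfl

theorem drop_zero (α : DottedComposition) : α.drop 0 = α := rfl

theorem take_length (α : DottedComposition) : α.take α.parts.length = α :=
  ext List.take_length

theorem drop_length (α : DottedComposition) : α.drop α.parts.length = nil :=
  ext List.drop_length

end DottedComposition

namespace sQSym

open DottedComposition

theorem M_nil : M nil = 1 := by
  refine Subtype.ext (ext_coeff fun S a => ?_)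
  rw [coeff_M, Subalgebra.coe_one, coeff_one]
  refine if_congr ?_ rfl rfl
  rw [nil, ← List.length_eq_zero_iff]
  simp [shape, and_comm]

theorem twoAlphabets_tmul (f g : sQSym) :
    twoAlphabets (f ⊗ₜ g) = rename inlEmb (f : SuperSeries ℕ) * rename inrEmb (g : SuperSeries ℕ) :=
  rfl

theorem coeff_twoAlphabets_tmul (f g : sQSym) (S T : Finset ℕ) (a b : ℕ →₀ ℕ) :
    coeff (joinSet inlEmb inrEmb S T) (joinExp inlEmb inrEmb a b) (twoAlphabets (f ⊗ₜ g)) =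
      coeff S a (f : SuperSeries ℕ) * coeff T b (g : SuperSeries ℕ) := by
  rw [twoAlphabets_tmul, coeff_join_mul isOrderedUnion_inlEmb_inrEmb]

/-- The coordinates of a tensor in the product basis can be read off from its series, as
coefficients at joins of two leading monomials. -/
theorem twoAlphabets_injective : Function.Injective twoAlphabets := by
  rw [← LinearMap.ker_eq_bot, LinearMap.ker_eq_bot']
  intro t ht
  have key : ∀ t α β, (basisM.tensorProduct basisM).repr t (α, β) =
      coeff (joinSet inlEmb inrEmb (leadSet α.parts) (leadSet β.parts))
        (joinExp inlEmb inrEmb (leadExp α.parts) (leadExp β.parts)) (twoAlphabets t) := by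
    intro t α β
    induction t using TensorProduct.induction_on with
    | zero => simp
    | tmul f g =>
      rw [coeff_twoAlphabets_tmul, Module.Basis.tensorProduct_repr_tmul_apply, basisM_repr,
        basisM_repr, smul_eq_mul, mul_comm]
      rfl
    | add x y hx hy => simp only [map_add, Finsupp.add_apply, hx, hy]
  rw [← (basisM.tensorProduct basisM).repr.map_eq_zero_iff]
  ext ⟨α, β⟩
  rw [key, ht, map_zero, Finsupp.zero_apply]

/-- The linear map with `M_α ↦ ∑ M_β ⊗ M_γ`, the sum over the factorizations `α = β · γ`. -/
noncomputable def deconcatenate : sQSym →ₗ[ℚ] sQSym ⊗[ℚ] sQSym :=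
  basisM.constr ℚ fun α => ∑ k ∈ Finset.range (α.parts.length + 1), M (α.take k) ⊗ₜ[ℚ] M (α.drop k)

theorem deconcatenate_M (α : DottedComposition) : deconcatenate (M α) =
    ∑ k ∈ Finset.range (α.parts.length + 1), M (α.take k) ⊗ₜ[ℚ] M (α.drop k) := by
  rw [deconcatenate, ← basisM_apply, Module.Basis.constr_basis]

theorem coeff_eval_M (J : Type) [LinearOrder J] (α : DottedComposition) (S : Finset J)
    (a : J →₀ ℕ) : coeff S a (eval J (M α)) = if shape S a = α.parts then 1 else 0 := by
  rw [coeff_eval, coef_M]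
  refine if_congr ?_ rfl rfl
  exact ⟨fun h => h ▸ rfl, fun h => DottedComposition.ext h.symm⟩

/-- On `M α`, a joined monomial has coefficient `1` exactly when the shapes of its two halves
concatenate to `α`, which happens for a single cut of `α`. -/
theorem twoAlphabets_deconcatenate (f : sQSym) :
    twoAlphabets (deconcatenate f) = eval (ℕ ⊕ₗ ℕ) f := by
  suffices h : twoAlphabets ∘ₗ deconcatenate = (evalHom (ℕ ⊕ₗ ℕ)).toLinearMap from
    LinearMap.congr_fun h f
  refine linearMap_ext fun α => ?_
  rw [LinearMap.comp_apply, deconcatenate_M, AlgHom.toLinearMap_apply, evalHom_apply, map_sum]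
  refine ext_join isOrderedUnion_inlEmb_inrEmb fun S T a b => ?_
  rw [coeff_eval_M, shape_join isOrderedUnion_inlEmb_inrEmb, map_sum]
  simp only [coeff_twoAlphabets_tmul, coeff_M, ← ite_and, mul_ite, mul_one, mul_zero]
  split_ifs with h
  · rw [Finset.sum_eq_single (shape S a).length]
    · rw [if_pos]
      simp [take, drop, ← h]
    · intro k hk hne
      refine if_neg fun h' => hne ?_
      rw [h'.2, length_take_le (Nat.lt_succ_iff.1 (Finset.mem_range.1 hk))]
    · intro h'
      refine absurd (Finset.mem_range.2 ?_) h'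
      rw [← h, List.length_append]
      omega
  · refine Finset.sum_eq_zero fun k _ => if_neg fun h' => h ?_
    rw [h'.1, h'.2]
    exact List.take_append_drop k α.parts

/-- The constant term. -/
noncomputable def constantTerm : sQSym →ₗ[ℚ] ℚ := coeff ∅ 0 ∘ₗ sQSym.val.toLinearMap

theorem constantTerm_apply (f : sQSym) : constantTerm f = coeff ∅ 0 (f : SuperSeries ℕ) := rfl

theorem constantTerm_M (α : DottedComposition) :
    constantTerm (M α) = if α.parts = [] then 1 else 0 := by
  rw [constantTerm_apply, coeff_M]
  simp [shape, eq_comm]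

theorem constantTerm_M_of_ne {α : DottedComposition} (h : α.parts ≠ []) :
    constantTerm (M α) = 0 := by
  rw [constantTerm_M, if_neg h]

theorem constantTerm_M_nil : constantTerm (M nil) = 1 := by
  rw [constantTerm_M]; rfl

noncomputable instance : Coalgebra ℚ sQSym where
  comul := deconcatenate
  counit := constantTerm
  coassoc := by
    refine linearMap_ext fun α => ?_
    simp only [LinearMap.comp_apply, deconcatenate_M, map_sum, LinearMap.rTensor_tmul,
      LinearMap.lTensor_tmul, TensorProduct.sum_tmul, TensorProduct.tmul_sum,
      LinearEquiv.coe_coe, TensorProduct.assoc_tmul]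
    rw [Finset.sum_sigma', Finset.sum_sigma']
    -- Cutting at `k` and then the left piece at `j ≤ k` gives the same three pieces as cutting at
    -- `j` and then the right piece at `k - j`.
    refine Finset.sum_bij' (fun p _ => ⟨p.2, p.1 - p.2⟩) (fun p _ => ⟨p.1 + p.2, p.1⟩)
      ?_ ?_ ?_ ?_ ?_
    · rintro ⟨k, j⟩ h
      simp [take, drop] at h ⊢
      omega
    · rintro ⟨k, j⟩ h
      simp [take, drop] at h ⊢
      omega
    · rintro ⟨k, j⟩ h
      simp [take] at h ⊢
      omega
    · rintro ⟨k, j⟩ h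
      simp
    · rintro ⟨k, j⟩ h
      simp [take] at h
      have e1 : (α.take k).take j = α.take j :=
        DottedComposition.ext (by simp only [take, List.take_take]; congr 1; omega)
      have e2 : (α.take k).drop j = (α.drop j).take (k - j) :=
        DottedComposition.ext (by simp only [take, drop, List.drop_take])
      have e3 : α.drop k = (α.drop j).drop (k - j) :=
        DottedComposition.ext (by simp only [drop, List.drop_drop]; congr 1; omega)
      rw [e1, e2, e3]
  rTensor_counit_comp_comul := by
    refine linearMap_ext fun α => ?_
    simp only [LinearMap.comp_apply, deconcatenate_M, map_sum, LinearMap.rTensor_tmul,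
      TensorProduct.mk_apply]
    rw [Finset.sum_eq_single 0]
    · rw [take_zero, constantTerm_M_nil, drop_zero]
    · intro k hk hne
      rw [constantTerm_M_of_ne, TensorProduct.zero_tmul]
      rw [← List.length_pos_iff, length_take_le (Nat.lt_succ_iff.1 (Finset.mem_range.1 hk))]
      omega
    · simp
  lTensor_counit_comp_comul := by
    refine linearMap_ext fun α => ?_
    simp only [LinearMap.comp_apply, deconcatenate_M, map_sum, LinearMap.lTensor_tmul,
      TensorProduct.mk_apply, LinearMap.flip_apply]
    rw [Finset.sum_eq_single α.parts.length]
    · rw [take_length, drop_length, constantTerm_M_nil]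
    · intro k hk hne
      rw [constantTerm_M_of_ne, TensorProduct.tmul_zero]
      have := Finset.mem_range.1 hk
      simp [drop]
      omega
    · simp

theorem counit_eq_constantTerm (f : sQSym) : Coalgebra.counit (R := ℚ) f = constantTerm f := rfl

theorem comul_M (α : DottedComposition) : Coalgebra.comul (R := ℚ) (M α) =
    ∑ k ∈ Finset.range (α.parts.length + 1), M (α.take k) ⊗ₜ[ℚ] M (α.drop k) :=
  deconcatenate_M α

theorem twoAlphabets_comul (f : sQSym) :
    twoAlphabets (Coalgebra.comul f) = eval (ℕ ⊕ₗ ℕ) f :=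
  twoAlphabets_deconcatenate f

theorem setOf_append_eq (α : DottedComposition) :
    {p : DottedComposition × DottedComposition | p.1.append p.2 = α} =
      ((Finset.range (α.parts.length + 1)).image fun k => (α.take k, α.drop k) :
        Finset (DottedComposition × DottedComposition)) := by
  ext ⟨β, γ⟩
  simp only [Set.mem_ofPred_eq, Finset.coe_image, Set.mem_image, Finset.mem_coe, Finset.mem_range,
    Prod.mk.injEq]
  constructor
  · rintro rfl
    refine ⟨β.parts.length, ?_, DottedComposition.ext ?_, DottedComposition.ext ?_⟩
    · simp [append]
    · simp [append, take]
    · simp [append, drop]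
  · rintro ⟨k, -, rfl, rfl⟩
    exact append_take_drop α k

theorem comul_M_eq_finsum (α : DottedComposition) : Coalgebra.comul (R := ℚ) (M α) =
    ∑ᶠ p ∈ {p : DottedComposition × DottedComposition | p.1.append p.2 = α},
      M p.1 ⊗ₜ[ℚ] M p.2 := by
  rw [setOf_append_eq, finsum_mem_coe_finset, Finset.sum_image, comul_M]
  intro k hk j hj h
  -- Different cuts give different factorizations, since the length of the left factor recovers the
  -- cut.
  have h' := congrArg (fun p => p.1.parts.length) h
  simp only at h'
  rwa [length_take_le (Nat.lt_succ_iff.1 (Finset.mem_range.1 hk)),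
    length_take_le (Nat.lt_succ_iff.1 (Finset.mem_range.1 hj))] at h'

end sQSym

/-! ### Multiplicativity of the coproduct, gradings and connectedness -/

theorem SuperSeries.card_of_coeff_rename_ne_zero {I J : Type} [LinearOrder I] [LinearOrder J]
    (e : I ↪o J) {f : SuperSeries I} {m : ℕ} (hf : ∀ S a, coeff S a f ≠ 0 → S.card = m)
    (S : Finset J) (a : J →₀ ℕ) (h : coeff S a (rename e f) ≠ 0) : S.card = m := by
  obtain ⟨T, b, rfl, rfl⟩ := exists_eq_map_of_coeff_rename_ne_zero h
  rw [coeff_rename_map] at h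
  rw [Finset.card_map, hf _ _ h]

namespace DottedComposition

theorem degree_take_add_degree_drop (α : DottedComposition) (k : ℕ) :
    (α.take k).degree + (α.drop k).degree = α.degree := by
  conv_rhs => rw [← α.append_take_drop k]
  simp [degree, append]

theorem dots_take_add_dots_drop (α : DottedComposition) (k : ℕ) :
    (α.take k).dots + (α.drop k).dots = α.dots := by
  conv_rhs => rw [← α.append_take_drop k]
  simp [dots, append]

theorem eq_nil {α : DottedComposition} (h : α.parts = []) : α = nil := ext h

end DottedComposition

namespace sQSym

open DottedComposition

/-- The homomorphism `f ⊗ g ↦ f(x; θ) g(y; φ)`, for the signed product of `sQSym ⊗ sQSym`. -/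
noncomputable def twoAlphabetsHom :
    GradedTensorProduct ℚ fermionic fermionic →ₐ[ℚ] SuperSeries (ℕ ⊕ₗ ℕ) :=
  GradedTensorProduct.lift fermionic fermionic ((renameHom inlEmb).comp sQSym.val)
    ((renameHom inrEmb).comp sQSym.val) fun i j f g => by
      -- The universal property of the signed tensor product asks that the images of the two factors
      -- commute up to the sign of their degrees; renaming preserves the fermionic degree.
      have h := mul_comm_of_card
        (card_of_coeff_rename_ne_zero inlEmb (f := ((f : sQSym) : SuperSeries ℕ)) f.2)
        (card_of_coeff_rename_ne_zero inrEmb (f := ((g : sQSym) : SuperSeries ℕ)) g.2)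
      refine h.trans ?_
      rw [Units.smul_def, ← Int.cast_smul_eq_zsmul ℚ, mul_comm]
      simp
      rfl

theorem twoAlphabetsHom_of (t : sQSym ⊗[ℚ] sQSym) :
    twoAlphabetsHom (GradedTensorProduct.of ℚ fermionic fermionic t) = twoAlphabets t := rfl

theorem isSuperCommutative : IsSuperCommutative fermionic (K := ℚ) := by
  intro m n f hf g hg
  refine Subtype.ext ((mul_comm_of_card hf hg).trans ?_)
  have h : ((-1 : sQSym) ^ (m * n)) = algebraMap ℚ sQSym ((-1) ^ (m * n)) := by simp
  rw [h, ← Algebra.smul_def]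
  rfl

/-- Both sides have the same image under the injective homomorphism `twoAlphabetsHom`, because
evaluation at the union of the two alphabets is multiplicative. -/
theorem comul_mul (f g : sQSym) :
    GradedTensorProduct.of ℚ fermionic fermionic (Coalgebra.comul (R := ℚ) (f * g)) =
      GradedTensorProduct.of ℚ fermionic fermionic (Coalgebra.comul (R := ℚ) f) *
        GradedTensorProduct.of ℚ fermionic fermionic (Coalgebra.comul (R := ℚ) g) := by
  have hinj : Function.Injective twoAlphabetsHom := fun s t h => twoAlphabets_injective h
  refine hinj ?_
  rw [map_mul twoAlphabetsHom, twoAlphabetsHom_of, twoAlphabetsHom_of, twoAlphabetsHom_of,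
    twoAlphabets_comul, twoAlphabets_comul, twoAlphabets_comul, ← evalHom_apply, map_mul, evalHom_apply, evalHom_apply]

theorem comul_one : Coalgebra.comul (R := ℚ) (1 : sQSym) = 1 ⊗ₜ[ℚ] 1 := by
  rw [← M_nil, comul_M]
  simp [nil, take, drop]

theorem counit_mul (f g : sQSym) : Coalgebra.counit (R := ℚ) (f * g) =
    Coalgebra.counit (R := ℚ) f * Coalgebra.counit (R := ℚ) g := by
  simp only [counit_eq_constantTerm, constantTerm_apply, Subalgebra.coe_mul]
  rw [coeff_mul]
  simp [sgn_empty_left]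

theorem counit_one : Coalgebra.counit (R := ℚ) (1 : sQSym) = 1 := by
  rw [counit_eq_constantTerm, ← M_nil, constantTerm_M_nil]

theorem M_mem_bihomogeneous (α : DottedComposition) : M α ∈ bihomogeneous α.degree α.dots := by
  intro S a h
  rw [coeff_M] at h
  have hs : shape S a = α.parts := by
    by_contra hs
    exact h (if_neg hs)
  rw [← shape_degree S a, ← shape_card S a, hs]
  exact ⟨rfl, rfl⟩

theorem M_mem_fermionic (α : DottedComposition) : M α ∈ fermionic α.dots :=
  fun S a h => (M_mem_bihomogeneous α S a h).2

theorem dots_of_mem_fermionic {n : ℕ} {f : sQSym} (hf : f ∈ fermionic n) {α : DottedComposition}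
    (h : coef α f ≠ 0) : α.dots = n := by
  rw [← card_leadSet, hf _ _ h]

theorem M_mem_homogeneous (α : DottedComposition) : M α ∈ homogeneous (α.degree + α.dots) :=
  Submodule.mem_iSup_of_mem (α.degree, α.dots) (Submodule.mem_iSup_of_mem
    (Finset.HasAntidiagonal.mem_antidiagonal.2 rfl) (M_mem_bihomogeneous α))

/-- To prove that a linear map sends `f` into a submodule, it suffices to consider the `M_α` that
occur in `f`. -/
theorem map_mem_of_coef {V : Type} [AddCommGroup V] [Module ℚ V] {φ : sQSym →ₗ[ℚ] V}
    {P : Submodule ℚ V} {f : sQSym} (h : ∀ α, coef α f ≠ 0 → φ (M α) ∈ P) : φ f ∈ P := by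
  rw [← sum_coef_smul_M f, map_sum]
  refine Submodule.sum_mem _ fun α hα => ?_
  rw [map_smul]
  exact P.smul_mem _ (h α (Finsupp.mem_support_iff.1 hα))

/-- Replaces the supremum of bihomogeneous subspaces by a condition on single monomials. For the
converse, expand `f` in the basis: each `M α` that occurs is bihomogeneous of the right weight. -/
theorem mem_homogeneous {n : ℕ} {f : sQSym} : f ∈ homogeneous n ↔
    ∀ S a, coeff S a (f : SuperSeries ℕ) ≠ 0 → a.degree + S.card = n := by
  constructor
  · intro hf S a h
    by_contra hne
    have hle : homogeneous n ≤ LinearMap.ker (coeff S a ∘ₗ sQSym.val.toLinearMap) := by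
      refine iSup₂_le fun p hp g hg => ?_
      rw [LinearMap.mem_ker]
      by_contra h0
      obtain ⟨h1, h2⟩ := hg S a h0
      rw [h1, h2] at hne
      exact hne (Finset.HasAntidiagonal.mem_antidiagonal.1 hp)
    exact h (LinearMap.mem_ker.1 (hle hf))
  · intro h
    refine map_mem_of_coef (φ := LinearMap.id) fun α hα => ?_
    have := h _ _ hα
    rw [card_leadSet, degree_leadExp] at this
    rw [← this]
    exact M_mem_homogeneous α

theorem weight_of_mem_homogeneous {n : ℕ} {f : sQSym} (hf : f ∈ homogeneous n)
    {α : DottedComposition} (h : coef α f ≠ 0) : α.degree + α.dots = n := by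
  rw [← card_leadSet, ← degree_leadExp, mem_homogeneous.1 hf _ _ h]

theorem homogeneous_isInternal : DirectSum.IsInternal homogeneous := by
  rw [DirectSum.isInternal_submodule_iff_iSupIndep_and_iSup_eq_top]
  constructor
  · rw [iSupIndep_def]
    intro n
    rw [Submodule.disjoint_def]
    intro f hf hf'
    refine Subtype.ext (ext_coeff fun S a => ?_)
    by_contra h0
    have hn := mem_homogeneous.1 hf S a fun h => h0 (h.trans (map_zero _).symm)
    have hle : (⨆ j, ⨆ (_ : j ≠ n), homogeneous j) ≤
        LinearMap.ker (coeff S a ∘ₗ sQSym.val.toLinearMap) := by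
      refine iSup₂_le fun j hj g hg => ?_
      rw [LinearMap.mem_ker]
      by_contra h1
      exact hj ((mem_homogeneous.1 hg S a h1).symm.trans hn)
    exact h0 ((LinearMap.mem_ker.1 (hle hf')).trans (map_zero _).symm)
  · rw [eq_top_iff]
    intro f _
    exact map_mem_of_coef (φ := LinearMap.id) fun α _ =>
      Submodule.mem_iSup_of_mem _ (M_mem_homogeneous α)

theorem homogeneous_gradedMonoid : SetLike.GradedMonoid homogeneous where
  one_mem := by
    rw [← M_nil]
    exact M_mem_homogeneous nil
  mul_mem := by
    intro i j f g hf hg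
    refine mem_homogeneous.2 fun S a h => ?_
    obtain ⟨T, U, b, c, h1, h2, h3, h4⟩ := exists_of_coeff_mul_ne_zero h
    rw [← h3, ← h4, ← mem_homogeneous.1 hf _ _ h1, ← mem_homogeneous.1 hg _ _ h2]
    ring

/-- A subspace spanned by elements `M_α` of given weight is mapped by the coproduct into the span of
tensors of the same weight. -/
theorem comul_mem_of_weight {G : ℕ → Submodule ℚ sQSym} {w : DottedComposition → ℕ}
    (hw : ∀ α k, w (α.take k) + w (α.drop k) = w α) (hM : ∀ α, M α ∈ G (w α))
    {n : ℕ} {f : sQSym} (hf : ∀ α, coef α f ≠ 0 → w α = n) :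
    Coalgebra.comul (R := ℚ) f ∈ ⨆ p ∈ Finset.HasAntidiagonal.antidiagonal n,
      LinearMap.range (TensorProduct.mapIncl (G p.1) (G p.2)) := by
  refine map_mem_of_coef fun α hα => ?_
  rw [comul_M]
  refine Submodule.sum_mem _ fun k _ => ?_
  refine Submodule.mem_iSup_of_mem (w (α.take k), w (α.drop k)) (Submodule.mem_iSup_of_mem ?_ ?_)
  · rw [Finset.HasAntidiagonal.mem_antidiagonal, hw, hf α hα]
  · exact ⟨⟨_, hM _⟩ ⊗ₜ ⟨_, hM _⟩, rfl⟩

/-- Every part has positive weight, so only the empty composition has weight zero, and it gives `1`.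
The counit shows that `1` is nonzero. -/
theorem finrank_homogeneous_zero : Module.finrank ℚ (homogeneous 0) = 1 := by
  have h : homogeneous 0 = Submodule.span ℚ {(1 : sQSym)} := by
    refine le_antisymm (fun f hf => ?_) ?_
    · refine map_mem_of_coef (φ := LinearMap.id) fun α hα => ?_
      have hw := weight_of_mem_homogeneous hf hα
      have hα : α = nil := by
        have h1 : leadSet α.parts = ∅ := Finset.card_eq_zero.1 (by rw [card_leadSet]; omega)
        have h2 : leadExp α.parts = 0 :=
          (Finsupp.degree_eq_zero_iff _).1 (by rw [degree_leadExp]; omega)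
        refine DottedComposition.ext ?_
        rw [← shape_lead α.zero_notMem, h1, h2]
        simp [shape, nil]
      rw [hα, M_nil]
      exact Submodule.mem_span_singleton_self 1
    · rw [Submodule.span_singleton_le_iff_mem]
      exact homogeneous_gradedMonoid.one_mem
  rw [h]
  refine finrank_span_singleton fun h1 => ?_
  have := counit_one
  rw [h1, map_zero] at this
  exact zero_ne_one this

theorem isGradedConnected : IsGradedConnected homogeneous where
  isInternal := homogeneous_isInternal
  gradedMonoid := homogeneous_gradedMonoid
  comul_mem n f hf := by
    refine comul_mem_of_weight (w := fun α => α.degree + α.dots) (fun α k => ?_)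
      M_mem_homogeneous fun α hα => weight_of_mem_homogeneous hf hα
    rw [← α.degree_take_add_degree_drop k, ← α.dots_take_add_dots_drop k]
    ring
  finrank_zero := finrank_homogeneous_zero

/-! ### Convolution inverses and the antipode -/

/-- The values on the basis `M` of the left inverse, for the convolution product, of the linear map
`M_α ↦ φ α`, where `φ` takes the empty composition to `1`. -/
noncomputable def convInv (φ : DottedComposition → sQSym) (α : DottedComposition) : sQSym :=
  if α.parts = [] then 1 else
    -∑ k ∈ (Finset.range α.parts.length).attach, convInv φ (α.take k) * φ (α.drop k)
termination_by α.parts.length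
decreasing_by
  have := Finset.mem_range.1 k.2
  simpa [take] using this

theorem convInv_nil (φ : DottedComposition → sQSym) : convInv φ nil = 1 := by
  rw [convInv]; rfl

theorem convInv_of_ne (φ : DottedComposition → sQSym) {α : DottedComposition} (h : α.parts ≠ []) :
    convInv φ α = -∑ k ∈ Finset.range α.parts.length, convInv φ (α.take k) * φ (α.drop k) := by
  rw [convInv, if_neg h, ← Finset.sum_attach (Finset.range _)]

/-- The linear map with prescribed values on the basis `M`. -/
noncomputable def ofValues (φ : DottedComposition → sQSym) : sQSym →ₗ[ℚ] sQSym :=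
  basisM.constr ℚ φ

theorem ofValues_M (φ : DottedComposition → sQSym) (α : DottedComposition) :
    ofValues φ (M α) = φ α := by
  rw [ofValues, ← basisM_apply, Module.Basis.constr_basis]

/-- The cut at the end of `α` contributes `convInv` at `α` times `φ 1 = 1`, and the recursion makes
it the negative of the sum of all other cuts. It is stated for general `φ` because it is used for
the identity and again for the antipode. -/
theorem convInv_mul {φ : sQSym →ₗ[ℚ] sQSym} (h : φ 1 = 1) :
    LinearMap.mul' ℚ sQSym ∘ₗ TensorProduct.map (ofValues (convInv fun α => φ (M α))) φ ∘ₗ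
      Coalgebra.comul = Algebra.linearMap ℚ sQSym ∘ₗ Coalgebra.counit := by
  refine linearMap_ext fun α => ?_
  simp only [LinearMap.comp_apply, comul_M, map_sum, TensorProduct.map_tmul,
    LinearMap.mul'_apply, ofValues_M]
  rw [Finset.sum_range_succ, take_length, drop_length, M_nil, h, mul_one, counit_eq_constantTerm]
  by_cases hα : α.parts = []
  · rw [eq_nil hα, convInv_nil, constantTerm_M_nil]
    simp [nil]
  · rw [convInv_of_ne _ hα, constantTerm_M_of_ne hα, map_zero, add_neg_cancel]

/-- The antipode of `sQSym`. -/
noncomputable def antipode : sQSym →ₗ[ℚ] sQSym := ofValues (convInv M)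

theorem antipode_one : antipode 1 = 1 := by
  rw [← M_nil, antipode, ofValues_M, convInv_nil, M_nil]

theorem antipode_left : LinearMap.mul' ℚ sQSym ∘ₗ antipode.rTensor sQSym ∘ₗ Coalgebra.comul =
    Algebra.linearMap ℚ sQSym ∘ₗ Coalgebra.counit :=
  convInv_mul (φ := LinearMap.id) rfl

/-- In the convolution monoid the antipode `s` is a left inverse of the identity map `i`, and `s`
has a left inverse `t` in turn. Then `t = t * (s * i) = (t * s) * i = i`, so `i * s = 1`. -/
theorem antipode_right : LinearMap.mul' ℚ sQSym ∘ₗ antipode.lTensor sQSym ∘ₗ Coalgebra.comul =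
    Algebra.linearMap ℚ sQSym ∘ₗ Coalgebra.counit := by
  let i : WithConv (sQSym →ₗ[ℚ] sQSym) := WithConv.toConv LinearMap.id
  let s : WithConv (sQSym →ₗ[ℚ] sQSym) := WithConv.toConv antipode
  let t : WithConv (sQSym →ₗ[ℚ] sQSym) :=
    WithConv.toConv (ofValues (convInv fun α => antipode (M α)))
  have h1 : s * i = 1 := congrArg WithConv.toConv antipode_left
  have h2 : t * s = 1 := congrArg WithConv.toConv (convInv_mul antipode_one)
  have h3 : t = i := by rw [← mul_one t, ← h1, ← mul_assoc, h2, one_mul]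
  rw [h3] at h2
  exact congrArg WithConv.ofConv h2

theorem antipode_M_mem_fermionic (α : DottedComposition) : antipode (M α) ∈ fermionic α.dots := by
  rw [antipode, ofValues_M]
  induction h : α.parts.length using Nat.strong_induction_on generalizing α with
  | _ n ih =>
    by_cases hα : α.parts = []
    · rw [eq_nil hα, convInv_nil]
      exact SetLike.GradedOne.one_mem
    · rw [convInv_of_ne _ hα]
      refine Submodule.neg_mem _ (Submodule.sum_mem _ fun k hk => ?_)
      rw [Finset.mem_range] at hk
      rw [← α.dots_take_add_dots_drop k]
      refine SetLike.GradedMul.mul_mem (ih k (h ▸ hk) _ (length_take_le hk.le)) (M_mem_fermionic _)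

theorem isSuperHopfAlgebra : IsSuperHopfAlgebra fermionic antipode where
  comul_one := comul_one
  comul_mul := comul_mul
  counit_one := counit_one
  counit_mul := counit_mul
  comul_mem _ _ hf := comul_mem_of_weight dots_take_add_dots_drop M_mem_fermionic
    fun _ hα => dots_of_mem_fermionic hf hα
  antipode_mem _ _ hf := map_mem_of_coef fun α hα =>
    dots_of_mem_fermionic hf hα ▸ antipode_M_mem_fermionic α
  antipode_left := antipode_left
  antipode_right := antipode_right

end sQSym

/-! ### Permutations and products of signs over pairs -/

/-- Functions on a finite type with the same multiset of values differ by a permutation. -/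
theorem exists_perm_of_map_univ_eq {ι β : Type} [Fintype ι] [DecidableEq β] {φ ψ : ι → β}
    (h : Finset.univ.val.map φ = Finset.univ.val.map ψ) :
    ∃ σ : Equiv.Perm ι, ∀ i, ψ (σ i) = φ i := by
  -- Fibres over the same value have equal size; bijections between them are glued to a permutation.
  have hc : ∀ b, Nonempty ({i // φ i = b} ≃ {i // ψ i = b}) := by
    intro b
    rw [← Fintype.card_eq, Fintype.card_subtype, Fintype.card_subtype]
    have := congrArg (Multiset.count b) h
    rw [Multiset.count_map, Multiset.count_map] at this
    simp only [eq_comm (a := b)] at this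
    exact this
  refine ⟨(Equiv.sigmaFiberEquiv φ).symm.trans
    ((Equiv.sigmaCongrRight fun b => (hc b).some).trans (Equiv.sigmaFiberEquiv ψ)), fun i => ?_⟩
  exact ((hc (φ i)).some ⟨i, rfl⟩).2

theorem neg_one_pow_card_filter {ι : Type} (s : Finset ι) (p : ι → Prop) [DecidablePred p] :
    (-1 : ℚ) ^ (s.filter p).card = ∏ i ∈ s, if p i then -1 else 1 := by
  rw [Finset.prod_ite, Finset.prod_const, Finset.prod_const_one, mul_one]

/-- A product over pairs may be computed by grouping the factors of `(x, y)` and `(y, x)`. -/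
theorem prod_prod_eq_of_symm {I : Type} [LinearOrder I] (S : Finset I) {F G : I → I → ℚ}
    (hF : ∀ x, F x x = 1) (hG : ∀ x, G x x = 1)
    (h : ∀ x ∈ S, ∀ y ∈ S, x < y → F x y * F y x = G x y * G y x) :
    ∏ x ∈ S, ∏ y ∈ S, F x y = ∏ x ∈ S, ∏ y ∈ S, G x y := by
  have key : ∀ H : I → I → ℚ, (∀ x, H x x = 1) → ∏ x ∈ S, ∏ y ∈ S, H x y =
      ∏ x ∈ S, ∏ y ∈ S, if x < y then H x y * H y x else 1 := by
    intro H hH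
    have h1 : ∏ x ∈ S, ∏ y ∈ S, H x y = (∏ x ∈ S, ∏ y ∈ S, if x < y then H x y else 1) *
        ∏ x ∈ S, ∏ y ∈ S, if y < x then H x y else 1 := by
      simp only [← Finset.prod_mul_distrib]
      refine Finset.prod_congr rfl fun x _ => Finset.prod_congr rfl fun y _ => ?_
      rcases lt_trichotomy x y with h | rfl | h
      · simp [h, h.not_gt]
      · simp [hH]
      · simp [h, h.not_gt]
    rw [h1, Finset.prod_comm (s := S) (t := S) (f := fun x y => if y < x then H x y else 1)]
    simp only [← Finset.prod_mul_distrib]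
    refine Finset.prod_congr rfl fun x _ => Finset.prod_congr rfl fun y _ => ?_
    split_ifs <;> simp
  rw [key F hF, key G hG]
  refine Finset.prod_congr rfl fun x hx => Finset.prod_congr rfl fun y hy => ?_
  split_ifs with hxy
  · exact h x hx y hy hxy
  · rfl

theorem prod_prod_ite_mul_self {I : Type} (S T : Finset I) (p : I → I → Prop)
    [∀ x y, Decidable (p x y)] :
    (∏ x ∈ S, ∏ y ∈ T, if p x y then (-1 : ℚ) else 1) *
      (∏ x ∈ S, ∏ y ∈ T, if p x y then (-1 : ℚ) else 1) = 1 := by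
  simp only [← Finset.prod_mul_distrib]
  refine Finset.prod_eq_one fun x _ => Finset.prod_eq_one fun y _ => ?_
  split_ifs <;> norm_num

/-! ### Pullback along arbitrary injections, with sorting signs -/

namespace SuperSeries

variable {I J : Type} [LinearOrder I] [LinearOrder J]

theorem sgn_eq_prod (T U : Finset I) :
    sgn T U = ∏ t ∈ T, ∏ u ∈ U, if u < t then -1 else 1 := by
  rw [sgn, neg_one_pow_card_filter, Finset.prod_product]

/-- The sign of the permutation that sorts the images under `e` of the elements of `S`. -/
def invSign (e : I ↪ J) (S : Finset I) : ℚ :=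
  ∏ x ∈ S, ∏ y ∈ S, if x < y ∧ e y < e x then -1 else 1

theorem invSign_mul_self (e : I ↪ J) (S : Finset I) : invSign e S * invSign e S = 1 :=
  prod_prod_ite_mul_self S S fun x y => x < y ∧ e y < e x

theorem invSign_orderEmbedding (e : I ↪o J) (S : Finset I) : invSign e.toEmbedding S = 1 := by
  refine Finset.prod_eq_one fun x _ => Finset.prod_eq_one fun y _ => if_neg ?_
  rintro ⟨h1, h2⟩
  exact h2.not_gt (e.lt_iff_lt.2 h1)

/-- Pairs inside `T` or inside `U` contribute equally to both sides. For a cross pair, the relative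
order before `e` differs from that after `e` exactly when `e` inverts the pair. This identity is
what makes `pullback` multiplicative. -/
theorem invSign_union (e : I ↪ J) {T U : Finset I} (h : Disjoint T U) :
    invSign e (T ∪ U) * sgn (T.map e) (U.map e) = sgn T U * (invSign e T * invSign e U) := by
  rw [sgn_eq_prod, sgn_eq_prod, invSign, Finset.prod_union h]
  simp only [Finset.prod_union h, Finset.prod_mul_distrib, Finset.prod_map]
  rw [Finset.prod_comm (s := U) (t := T)]
  have key : (∏ t ∈ T, ∏ u ∈ U, if t < u ∧ e u < e t then (-1 : ℚ) else 1) *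
      (∏ t ∈ T, ∏ u ∈ U, if u < t ∧ e t < e u then (-1 : ℚ) else 1) *
      (∏ t ∈ T, ∏ u ∈ U, if e u < e t then (-1 : ℚ) else 1) =
      ∏ t ∈ T, ∏ u ∈ U, if u < t then (-1 : ℚ) else 1 := by
    simp only [← Finset.prod_mul_distrib]
    refine Finset.prod_congr rfl fun t ht => Finset.prod_congr rfl fun u hu => ?_
    have hne : t ≠ u := fun h' => Finset.disjoint_left.1 h ht (h' ▸ hu)
    have hne' : e t ≠ e u := e.injective.ne hne
    rcases hne.lt_or_gt with h1 | h1 <;> rcases hne'.lt_or_gt with h2 | h2 <;>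
      simp [h1, h2, h1.not_gt, h2.not_gt]
  rw [← key, invSign, invSign]
  ring

/-- Substitute `x_i` for `x_{e i}` and `θ_i` for `θ_{e i}`, and zero for the variables outside the
image of `e`. -/
noncomputable def pullback (e : I ↪ J) : SuperSeries J →ₗ[ℚ] SuperSeries I where
  toFun f := ofCoeff fun S a => invSign e S * coeff (S.map e) (a.embDomain e) f
  map_add' f g := ext_coeff fun S a => by
    simp only [map_add, coeff_ofCoeff, mul_add]
  map_smul' c f := ext_coeff fun S a => by
    simp only [map_smul, coeff_ofCoeff, smul_eq_mul, RingHom.id_apply, mul_left_comm]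

theorem coeff_pullback (e : I ↪ J) (f : SuperSeries J) (S : Finset I) (a : I →₀ ℕ) :
    coeff S a (pullback e f) = invSign e S * coeff (S.map e) (a.embDomain e) f := rfl

theorem pullback_one (e : I ↪ J) : pullback e (1 : SuperSeries J) = 1 := by
  refine ext_coeff fun S a => ?_
  rw [coeff_pullback, coeff_one, coeff_one]
  simp only [Finset.map_eq_empty, Finsupp.embDomain_eq_zero]
  split_ifs with h
  · rw [h.1]; simp [invSign]
  · simp

theorem pullback_mul (e : I ↪ J) (f g : SuperSeries J) :
    pullback e (f * g) = pullback e f * pullback e g := by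
  refine ext_coeff fun S a => ?_
  rw [coeff_pullback, coeff_mul, coeff_mul, Finset.mul_sum]
  have hp : (S.map e).powerset = S.powerset.map (Finset.mapEmbedding e).toEmbedding := by
    ext T
    simp only [Finset.mem_powerset, Finset.mem_map, RelEmbedding.coe_toEmbedding,
      Finset.mapEmbedding_apply]
    rw [Finset.subset_map_iff]
    constructor
    · rintro ⟨u, hu, rfl⟩; exact ⟨u, hu, rfl⟩
    · rintro ⟨u, hu, rfl⟩; exact ⟨u, hu, rfl⟩
  rw [hp, Finset.sum_map]
  refine Finset.sum_congr rfl fun T hT => ?_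
  rw [← Finsupp.image_prodMap_embDomain_antidiagonal, Finset.sum_image, Finset.mul_sum]
  · refine Finset.sum_congr rfl fun p _ => ?_
    simp only [RelEmbedding.coe_toEmbedding, Finset.mapEmbedding_apply, Prod.map_fst,
      Prod.map_snd, coeff_pullback, ← Finset.map_sdiff]
    have h := invSign_union e (Finset.disjoint_sdiff (s := T) (t := S))
    rw [Finset.union_sdiff_of_subset (Finset.mem_powerset.1 hT)] at h
    linear_combination
      (coeff (T.map e) (p.1.embDomain e) f * coeff ((S \ T).map e) (p.2.embDomain e) g) * h
  · exact fun p _ q _ h => (Prod.map_injective.2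
      ⟨Finsupp.embDomain_injective _, Finsupp.embDomain_injective _⟩) h

/-- The involution `(x, y) ↦ (τ y, τ x)` preserves the set of inverted pairs, and `(p, q)` is its
only fixed point there. The other factors cancel in pairs. -/
theorem invSign_swap {p q : I} (hpq : p < q) {T : Finset I} (hp : p ∈ T) (hq : q ∈ T) :
    invSign (Equiv.swap p q).toEmbedding T = -1 := by
  set τ := Equiv.swap p q with hτ
  have hT : ∀ x ∈ T, τ x ∈ T := by
    intro x hx
    rw [hτ, Equiv.swap_apply_def]
    split_ifs <;> assumption
  rw [invSign, ← Finset.prod_product', ← Finset.mul_prod_erase _ _ (Finset.mk_mem_product hp hq)]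
  have h1 : (if p < q ∧ τ.toEmbedding q < τ.toEmbedding p then (-1 : ℚ) else 1) = -1 := by
    simp [hτ, hpq]
  rw [h1, Finset.prod_involution fun x _ => (τ x.2, τ x.1)]
  · norm_num
  · rintro ⟨x, y⟩ _
    simp only [Equiv.toEmbedding_apply, hτ, Equiv.swap_apply_self]
    by_cases h : x < y ∧ Equiv.swap p q y < Equiv.swap p q x
    · rw [if_pos h, if_pos h.symm]; norm_num
    · rw [if_neg h, if_neg fun h' => h h'.symm]; norm_num
  · rintro ⟨x, y⟩ hx h h'
    have hxy : x < y := by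
      by_contra h0
      exact h (if_neg fun h1 => h0 h1.1)
    have h2 : τ y = x := (Prod.mk.inj h').1
    have hy : τ y ≠ y := by rw [h2]; exact hxy.ne
    refine (Finset.mem_erase.1 hx).1 ?_
    rcases (Equiv.swap_apply_ne_self_iff.1 hy).2 with rfl | rfl
    · rw [hτ, Equiv.swap_apply_left] at h2
      exact absurd (h2 ▸ hxy) hpq.not_gt
    · rw [hτ, Equiv.swap_apply_right] at h2
      rw [h2]
  · rintro ⟨x, y⟩ hx
    simp only [Finset.mem_erase, Finset.mem_product, ne_eq, Prod.mk.injEq, not_and] at hx ⊢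
    refine ⟨fun h3 h4 => hx.1 ?_ ?_, hT _ hx.2.2, hT _ hx.2.1⟩
    · rw [← τ.apply_eq_iff_eq, h4, hτ, Equiv.swap_apply_left]
    · rw [← τ.apply_eq_iff_eq, h3, hτ, Equiv.swap_apply_right]
  · rintro ⟨x, y⟩ _
    simp [hτ]

/-- The sign of the monomial `θ_S x^a` in a monomial symmetric function. -/
def expSign (S : Finset I) (a : I →₀ ℕ) : ℚ :=
  ∏ x ∈ S, ∏ y ∈ S, if x < y ∧ a x < a y then -1 else 1

theorem expSign_mul_self (S : Finset I) (a : I →₀ ℕ) : expSign S a * expSign S a = 1 :=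
  prod_prod_ite_mul_self S S fun x y => x < y ∧ a x < a y

/-- When `e` reverses a pair, it also switches whether that pair is out of order for the exponents,
so the two sign changes compensate. Equal exponents would break this, since such a pair never
contributes to `expSign`. -/
theorem expSign_map (e : I ↪ J) {S : Finset I} {a : I →₀ ℕ} (ha : Set.InjOn a S) :
    invSign e S * expSign (S.map e) (a.embDomain e) = expSign S a := by
  rw [invSign, expSign, Finset.prod_map]
  simp only [Finset.prod_map, Finsupp.embDomain_apply_self, ← Finset.prod_mul_distrib]
  refine prod_prod_eq_of_symm S (fun x => by simp) (fun x => by simp) fun x hx y hy hxy => ?_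
  have hne' : e x ≠ e y := e.injective.ne hxy.ne
  have hne : a x ≠ a y := fun h => hxy.ne (ha hx hy h)
  rcases hne.lt_or_gt with h1 | h1 <;> rcases hne'.lt_or_gt with h2 | h2 <;>
    simp [h1, h2, h1.not_gt, h2.not_gt, hxy, hxy.not_gt]

/-- The unordered content of the shape of a monomial, in terms of the exponents at the indices with
and without a `θ`. -/
theorem coe_shape (S : Finset I) (a : I →₀ ℕ) : (shape S a : Multiset (ℕ × Bool)) =
    (S.val.map a).map (fun n => (n, true)) +
      ((a.support \ S).val.map a).map fun n => (n, false) := by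
  have h : (a.support ∪ S).val = S.val + (a.support \ S).val := by
    rw [← Finset.disjUnion_val _ _ Finset.disjoint_sdiff]
    congr 1
    rw [Finset.disjUnion_eq_union, Finset.union_sdiff_self_eq_union, Finset.union_comm]
  rw [shape, ← Multiset.map_coe, Finset.sort_eq, h, Multiset.map_add, Multiset.map_map,
    Multiset.map_map]
  congr 1
  · refine Multiset.map_congr rfl fun i hi => ?_
    have hi : i ∈ S := hi
    simp [hi]
  · refine Multiset.map_congr rfl fun i hi => ?_
    have hi : i ∉ S := (Finset.mem_sdiff.1 hi).2
    simp [hi]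

/-- Two monomials whose shapes are permutations of each other are images of the same monomial. -/
theorem exists_of_coe_shape_eq {S S' : Finset I} {a a' : I →₀ ℕ}
    (h : (shape S a : Multiset (ℕ × Bool)) = shape S' a') :
    ∃ (l : ℕ) (e e' : Fin l ↪ I) (T : Finset (Fin l)) (b : Fin l →₀ ℕ),
      S = T.map e ∧ a = b.embDomain e ∧ S' = T.map e' ∧ a' = b.embDomain e' := by
  have hc : (a'.support ∪ S').card = (a.support ∪ S).card := by
    have := congrArg Multiset.card h
    simpa [shape] using this.symm
  obtain ⟨l, hl⟩ : ∃ l, (a.support ∪ S).card = l := ⟨_, rfl⟩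
  have hl' := hc.trans hl
  set e := (a.support ∪ S).orderEmbOfFin hl with he
  set e' := (a'.support ∪ S').orderEmbOfFin hl' with he'
  have hφ : Finset.univ.val.map (fun k => (a (e k), decide (e k ∈ S))) =
      Finset.univ.val.map (fun k => (a' (e' k), decide (e' k ∈ S'))) := by
    unfold shape at h
    rw [← Finset.listMap_orderEmbOfFin_finRange _ hl,
      ← Finset.listMap_orderEmbOfFin_finRange _ hl', List.map_map, List.map_map,
      ← Multiset.map_coe, ← Multiset.map_coe] at h
    exact h
  -- `σ` matches the variables of the two monomials having the same exponent and the same dot; `e'`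
  -- composed with `σ` is then the second embedding.
  obtain ⟨σ, hσ⟩ := exists_perm_of_map_univ_eq hφ
  have key : ∀ k, a' (e' (σ k)) = a (e k) ∧ (e' (σ k) ∈ S' ↔ e k ∈ S) := fun k => by
    simpa using hσ k
  have r : Set.range e = ↑(a.support ∪ S) := Finset.range_orderEmbOfFin _ _
  have r' : Set.range (σ.toEmbedding.trans e'.toEmbedding) = ↑(a'.support ∪ S') := by
    rw [← Finset.range_orderEmbOfFin _ hl']
    exact EquivLike.range_comp e' σ
  refine ⟨l, e.toEmbedding, σ.toEmbedding.trans e'.toEmbedding,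
    Finset.univ.filter (fun k => e k ∈ S), a.comapDomain e e.injective.injOn, ?_, ?_, ?_, ?_⟩
  · ext i
    simp only [Finset.mem_map, Finset.mem_filter, Finset.mem_univ, true_and]
    constructor
    · intro hi
      have : i ∈ Set.range e := by rw [r]; simp [hi]
      obtain ⟨k, rfl⟩ := this
      exact ⟨k, hi, rfl⟩
    · rintro ⟨k, hk, rfl⟩; exact hk
  · refine (Finsupp.embDomain_comapDomain (f := e.toEmbedding) ?_).symm
    change _ ⊆ Set.range e
    rw [r]; simp
  · ext i
    simp only [Finset.mem_map, Finset.mem_filter, Finset.mem_univ, true_and]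
    constructor
    · intro hi
      have : i ∈ Set.range (σ.toEmbedding.trans e'.toEmbedding) := by rw [r']; simp [hi]
      obtain ⟨k, rfl⟩ := this
      exact ⟨k, (key k).2.1 hi, rfl⟩
    · rintro ⟨k, hk, rfl⟩; exact (key k).2.2 hk
  · have : a.comapDomain e e.injective.injOn = a'.comapDomain (σ.toEmbedding.trans e'.toEmbedding)
        (σ.toEmbedding.trans e'.toEmbedding).injective.injOn := by
      ext k; simpa using (key k).1.symm
    rw [this]
    refine (Finsupp.embDomain_comapDomain ?_).symm
    rw [r']; simp

end SuperSeries

/-! ### Superpartitions and the invariance of monomial symmetric functions -/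

namespace Superpartition

theorem ext' {Λ Γ : Superpartition} (h1 : Λ.anti = Γ.anti) (h2 : Λ.sym = Γ.sym) : Λ = Γ := by
  cases Λ; cases Γ; cases h1; cases h2; rfl

/-- The parts of `Λ`, those of the first partition being dotted. -/
def parts (Λ : Superpartition) : Multiset (ℕ × Bool) :=
  Λ.anti.val.map (fun n => (n, true)) + Λ.sym.map fun n => (n, false)

theorem map_add_map_inj {s s' t t' : Multiset ℕ}
    (h : s.map (fun n => (n, true)) + t.map (fun n => (n, false)) =
      s'.map (fun n => (n, true)) + t'.map fun n => (n, false)) : s = s' ∧ t = t' := by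
  constructor
  · have := congrArg (fun m => (m.filter fun p => p.2 = true).map Prod.fst) h
    simpa [Multiset.filter_add, Multiset.filter_map, Function.comp_def] using this
  · have := congrArg (fun m => (m.filter fun p => p.2 = false).map Prod.fst) h
    simpa [Multiset.filter_add, Multiset.filter_map, Function.comp_def] using this

theorem parts_injective : Function.Injective parts := fun Λ Γ h => by
  obtain ⟨h1, h2⟩ := map_add_map_inj h
  exact ext' (Finset.val_injective h1) h2

/-- A dotted composition whose parts are those of `Λ`. -/
noncomputable def toComposition (Λ : Superpartition) : DottedComposition :=
  ⟨Λ.parts.toList, by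
    have := Λ.zero_notMem
    simpa [parts] using this⟩

theorem coe_toComposition_parts (Λ : Superpartition) :
    (Λ.toComposition.parts : Multiset (ℕ × Bool)) = Λ.parts := Multiset.coe_toList _

theorem toComposition_injective : Function.Injective toComposition := fun Λ Γ h =>
  parts_injective (by rw [← coe_toComposition_parts, h, coe_toComposition_parts])

end Superpartition

section Monomial

variable {I J : Type} [LinearOrder I] [LinearOrder J]

theorem coe_shape_eq_parts_iff {S : Finset I} {a : I →₀ ℕ} {Λ : Superpartition} :
    (shape S a : Multiset (ℕ × Bool)) = Λ.parts ↔
      S.val.map a = Λ.anti.val ∧ (a.support \ S).val.map a = Λ.sym := by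
  rw [coe_shape, Superpartition.parts]
  exact ⟨Superpartition.map_add_map_inj, fun h => by rw [h.1, h.2]⟩

theorem injOn_of_coe_shape_eq {S : Finset I} {a : I →₀ ℕ} {Λ : Superpartition}
    (h : (shape S a : Multiset (ℕ × Bool)) = Λ.parts) : Set.InjOn a S := by
  have h1 := (coe_shape_eq_parts_iff.1 h).1
  have h2 : (S.val.map a).Nodup := h1 ▸ Λ.anti.nodup
  exact fun x hx y hy hxy => Multiset.inj_on_of_nodup_map h2 x hx y hy hxy

/-- The exponents at `S` form the first partition, which needs distinct parts: hence injectivity.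
The exponents off `S` come from the support, so no zero part appears. -/
theorem exists_coe_shape_eq {S : Finset I} {a : I →₀ ℕ} (h : Set.InjOn a S) :
    ∃ Λ : Superpartition, (shape S a : Multiset (ℕ × Bool)) = Λ.parts := by
  refine ⟨⟨⟨S.val.map a, (Multiset.nodup_map_iff_inj_on S.nodup).2 h⟩,
    (a.support \ S).val.map a, ?_⟩, coe_shape_eq_parts_iff.2 ⟨rfl, rfl⟩⟩
  intro h0
  obtain ⟨i, hi, h0⟩ := Multiset.mem_map.1 h0
  exact Finsupp.mem_support_iff.1 (Finset.mem_sdiff.1 hi).1 h0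

theorem coeff_monomialSymmetric (Λ : Superpartition) (S : Finset I) (a : I →₀ ℕ) :
    coeff S a (monomialSymmetric I Λ) =
      if (shape S a : Multiset (ℕ × Bool)) = Λ.parts then expSign S a else 0 := by
  have h : coeff S a (monomialSymmetric I Λ) =
    if S.val.map a = Λ.anti.val ∧ (a.support \ S).val.map a = Λ.sym then
      (-1) ^ ((S ×ˢ S).filter fun p => p.1 < p.2 ∧ a p.1 < a p.2).card else 0 := rfl
  rw [h, neg_one_pow_card_filter, Finset.prod_product]
  exact if_congr coe_shape_eq_parts_iff.symm rfl rfl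

theorem coe_shape_map (e : I ↪ J) (S : Finset I) (a : I →₀ ℕ) :
    (shape (S.map e) (a.embDomain e) : Multiset (ℕ × Bool)) = shape S a := by
  rw [coe_shape, coe_shape, Finsupp.support_embDomain, ← Finset.map_sdiff, Finset.map_val,
    Finset.map_val]
  have h : ∀ s : Multiset I, (s.map e).map (a.embDomain e) = s.map a := fun s => by
    rw [Multiset.map_map]
    exact Multiset.map_congr rfl fun i _ => Finsupp.embDomain_apply_self e a i
  rw [h, h]

/-- An injection keeps the multiset of parts of a monomial, and its sorting sign is absorbed by
`expSign_map`. This is the symmetry of `m_Λ` under all relabellings. -/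
theorem pullback_monomialSymmetric (e : I ↪ J) (Λ : Superpartition) :
    pullback e (monomialSymmetric J Λ) = monomialSymmetric I Λ := by
  refine ext_coeff fun S a => ?_
  rw [coeff_pullback, coeff_monomialSymmetric, coeff_monomialSymmetric, coe_shape_map]
  split_ifs with h
  · rw [expSign_map e (injOn_of_coe_shape_eq h)]
  · rw [mul_zero]

theorem pullback_orderEmbedding (e : I ↪o J) (f : SuperSeries J) :
    pullback e.toEmbedding f = restrict e f :=
  ext_coeff fun S a => by
    rw [coeff_pullback, invSign_orderEmbedding, one_mul, coeff_restrict]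

theorem restrict_monomialSymmetric (e : I ↪o J) (Λ : Superpartition) :
    restrict e (monomialSymmetric J Λ) = monomialSymmetric I Λ := by
  rw [← pullback_orderEmbedding, pullback_monomialSymmetric]

end Monomial

/-! ### Symmetric functions as the invariant subalgebra, spanned by the `m Λ` -/

namespace sQSym

open DottedComposition

/-- The monomial symmetric function `m_Λ` as a quasisymmetric function in superspace. -/
noncomputable def m (Λ : Superpartition) : sQSym :=
  ⟨monomialSymmetric ℕ Λ, by
    refine ⟨⟨(Λ.parts.map Prod.fst).sum + (Λ.parts.map fun p => if p.2 then 1 else 0).sum,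
      fun S a h => ?_⟩, fun S a S' a' h => ?_⟩
    · rw [coeff_monomialSymmetric] at h
      have hs : (shape S a : Multiset (ℕ × Bool)) = Λ.parts := by
        by_contra hs
        exact h (if_neg hs)
      rw [← hs, Multiset.map_coe, Multiset.map_coe, Multiset.sum_coe, Multiset.sum_coe, shape_card,
        shape_degree]
    · obtain ⟨l, e, e', T, b, rfl, rfl, rfl, rfl⟩ := exists_of_shape_eq h
      rw [← coeff_restrict, ← coeff_restrict, restrict_monomialSymmetric,
        restrict_monomialSymmetric]⟩

theorem coe_m (Λ : Superpartition) : (m Λ : SuperSeries ℕ) = monomialSymmetric ℕ Λ := rfl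

theorem coeff_m (Λ : Superpartition) (S : Finset ℕ) (a : ℕ →₀ ℕ) :
    coeff S a (m Λ : SuperSeries ℕ) =
      if (shape S a : Multiset (ℕ × Bool)) = Λ.parts then expSign S a else 0 :=
  coeff_monomialSymmetric Λ S a

/-- After restriction to any finite set of variables both sides become `m_Λ` in those variables.
Hence the coproduct of the symmetric functions is the restriction of that of `sQSym`. -/
theorem eval_m (J : Type) [LinearOrder J] (Λ : Superpartition) :
    eval J (m Λ) = monomialSymmetric J Λ := by
  refine ext_coeff fun S a => ?_
  obtain ⟨l, e, T, b, rfl, rfl⟩ := exists_eq_map S a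
  rw [← coeff_restrict, ← coeff_restrict, restrict_eval, coe_m, restrict_monomialSymmetric,
    restrict_monomialSymmetric]

/-- The symmetric functions in superspace, as a subalgebra of `sQSym`: the series whose pullbacks
along embeddings of a finite alphabet do not depend on the embedding. -/
noncomputable def symmetric : Subalgebra ℚ sQSym where
  carrier := {f | ∀ (l : ℕ) (e e' : Fin l ↪ ℕ),
    pullback e (f : SuperSeries ℕ) = pullback e' (f : SuperSeries ℕ)}
  mul_mem' := by
    intro f g hf hg l e e'
    rw [Subalgebra.coe_mul, pullback_mul, pullback_mul, hf l e e', hg l e e']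
  add_mem' := by
    intro f g hf hg l e e'
    rw [Subalgebra.coe_add, map_add, map_add, hf l e e', hg l e e']
  algebraMap_mem' := by
    intro r l e e'
    rw [Algebra.algebraMap_eq_smul_one, Subalgebra.coe_smul, Subalgebra.coe_one, map_smul, map_smul,
      pullback_one, pullback_one]

theorem m_mem_symmetric (Λ : Superpartition) : m Λ ∈ symmetric := by
  intro l e e'
  rw [coe_m, pullback_monomialSymmetric, pullback_monomialSymmetric]

/-- Exchanging two `θ`-indices that carry the same exponent fixes the monomial but reverses its
sign, so its coefficient equals its own negative. -/
theorem coeff_eq_zero_of_mem_symmetric {f : sQSym} (hf : f ∈ symmetric) {S : Finset ℕ}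
    {a : ℕ →₀ ℕ} (h : ¬ Set.InjOn a S) : coeff S a (f : SuperSeries ℕ) = 0 := by
  obtain ⟨l, e, T, b, rfl, rfl⟩ := exists_eq_map S a
  have hb : ∀ i, (b.embDomain e.toEmbedding) (e i) = b i :=
    fun i => Finsupp.embDomain_apply_self e.toEmbedding b i
  obtain ⟨p, hp, q, hq, hpq, hlt⟩ : ∃ p ∈ T, ∃ q ∈ T, b p = b q ∧ p < q := by
    simp only [Set.InjOn, not_forall] at h
    obtain ⟨x, hx, y, hy, hxy, hne⟩ := h
    simp only [Finset.coe_map, Set.mem_image] at hx hy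
    obtain ⟨i, hi, rfl⟩ := hx
    obtain ⟨j, hj, rfl⟩ := hy
    have hij : b i = b j := by rw [← hb i, ← hb j]; exact hxy
    have hne : i ≠ j := fun h => hne (h ▸ rfl)
    rcases hne.lt_or_gt with h | h
    · exact ⟨i, hi, j, hj, hij, h⟩
    · exact ⟨j, hj, i, hi, hij.symm, h⟩
  -- Invariance is applied to `e` and to `e` precomposed with the swap of the two positions.
  have h1 := congrArg (coeff T b) (hf l ((Equiv.swap p q).toEmbedding.trans e.toEmbedding)
    e.toEmbedding)
  have hs : invSign ((Equiv.swap p q).toEmbedding.trans e.toEmbedding) T = -1 := by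
    rw [← invSign_swap hlt hp hq]
    refine Finset.prod_congr rfl fun x _ => Finset.prod_congr rfl fun y _ => ?_
    refine if_congr (and_congr_right fun _ => ?_) rfl rfl
    exact e.lt_iff_lt
  have hT : T.map (Equiv.swap p q).toEmbedding = T := by
    refine Finset.eq_of_subset_of_card_le (fun x hx => ?_) (by simp)
    obtain ⟨y, hy, rfl⟩ := Finset.mem_map.1 hx
    rw [Equiv.toEmbedding_apply, Equiv.swap_apply_def]
    split_ifs <;> assumption
  have hb' : b.embDomain (Equiv.swap p q).toEmbedding = b := by
    ext x
    obtain ⟨y, rfl⟩ := (Equiv.swap p q).surjective x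
    refine (Finsupp.embDomain_apply_self (Equiv.swap p q).toEmbedding b y).trans ?_
    rw [Equiv.swap_apply_def]
    split_ifs with h2 h3
    · rw [h2, hpq]
    · rw [h3, hpq]
    · rfl
  have hb2 : b.embDomain ((Equiv.swap p q).toEmbedding.trans e.toEmbedding) =
      b.embDomain e.toEmbedding := by
    rw [Finsupp.embDomain_trans_apply, hb']
  rw [coeff_pullback, coeff_pullback, hs, invSign_orderEmbedding, ← Finset.map_map, hT, hb2] at h1
  linarith

/-- A symmetric function is determined by its coefficients at the monomials `toComposition Λ`. -/
theorem coeff_of_mem_symmetric {f : sQSym} (hf : f ∈ symmetric) {S : Finset ℕ} {a : ℕ →₀ ℕ}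
    {S' : Finset ℕ} {a' : ℕ →₀ ℕ} {Λ : Superpartition}
    (h : (shape S a : Multiset (ℕ × Bool)) = Λ.parts)
    (h' : (shape S' a' : Multiset (ℕ × Bool)) = Λ.parts) :
    coeff S a (f : SuperSeries ℕ) =
      expSign S' a' * coeff S' a' (f : SuperSeries ℕ) * expSign S a := by
  obtain ⟨l, e, e', T, b, rfl, rfl, rfl, rfl⟩ := exists_of_coe_shape_eq (h.trans h'.symm)
  have h1 := congrArg (coeff T b) (hf l e e')
  -- The coefficients of `f` and of `m Λ` transform by the same sorting signs; comparing with `m Λ`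
  -- expresses these signs through `expSign`.
  have h2 := congrArg (coeff T b) (m_mem_symmetric Λ l e e')
  rw [coeff_pullback, coeff_pullback] at h1 h2
  rw [coeff_m, coeff_m, if_pos h, if_pos h'] at h2
  have e1 := invSign_mul_self e T
  have e2 := invSign_mul_self e' T
  have e3 := expSign_mul_self (T.map e) (b.embDomain e)
  have e4 := expSign_mul_self (T.map e') (b.embDomain e')
  generalize invSign e T = s at *
  generalize invSign e' T = s' at *
  generalize expSign (T.map e) (b.embDomain e) = u at *
  generalize expSign (T.map e') (b.embDomain e') = u' at *
  generalize coeff (T.map e) (b.embDomain e) (f : SuperSeries ℕ) = x at *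
  generalize coeff (T.map e') (b.embDomain e') (f : SuperSeries ℕ) = x' at *
  have hx : x = s * s' * x' := by linear_combination s * h1 - x * e1
  have hu : u = s * s' * u' := by linear_combination s * h2 - u * e1
  rw [hu, hx]
  linear_combination (-s * s' * x') * e4

/-- The coefficient of `m_Λ` in a symmetric function. -/
noncomputable def symmCoef (Λ : Superpartition) (f : sQSym) : ℚ :=
  expSign (leadSet Λ.toComposition.parts) (leadExp Λ.toComposition.parts) * coef Λ.toComposition f

theorem finite_symmCoef_ne_zero (f : sQSym) : {Λ | symmCoef Λ f ≠ 0}.Finite := by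
  refine ((finite_coef_ne_zero f).preimage
    Superpartition.toComposition_injective.injOn).subset fun Λ h => ?_
  exact right_ne_zero_of_mul h

/-- If the exponents on `S` repeat, both sides vanish at `θ_S x^a`. Otherwise exactly one `m Λ`
contains the monomial, and symmetry transports the coefficient from the leading monomial of
`toComposition Λ`. -/
theorem sum_symmCoef_smul_m {f : sQSym} (hf : f ∈ symmetric) :
    ∑ Λ ∈ (finite_symmCoef_ne_zero f).toFinset, symmCoef Λ f • m Λ = f := by
  refine Subtype.ext (ext_coeff fun S a => ?_)
  rw [AddSubmonoidClass.coe_finsetSum, map_sum]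
  simp only [Subalgebra.coe_smul, map_smul, coeff_m, smul_eq_mul]
  by_cases h : Set.InjOn a S
  · obtain ⟨Λ, hΛ⟩ := exists_coe_shape_eq h
    have h1 : (shape (leadSet Λ.toComposition.parts) (leadExp Λ.toComposition.parts) :
        Multiset (ℕ × Bool)) = Λ.parts := by
      rw [shape_lead Λ.toComposition.zero_notMem, Λ.coe_toComposition_parts]
    rw [coeff_of_mem_symmetric hf hΛ h1, Finset.sum_eq_single Λ]
    · rw [if_pos hΛ]; rfl
    · intro Γ _ hne
      rw [if_neg, mul_zero]
      exact fun h' => hne (Superpartition.parts_injective (h'.symm.trans hΛ))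
    · intro h0
      rw [Set.Finite.mem_toFinset] at h0
      rw [not_not.1 h0, zero_mul]
  · rw [coeff_eq_zero_of_mem_symmetric hf h]
    refine Finset.sum_eq_zero fun Λ _ => ?_
    rw [if_neg fun h' => h (injOn_of_coe_shape_eq h'), mul_zero]

theorem toSubmodule_symmetric :
    Subalgebra.toSubmodule symmetric = Submodule.span ℚ (Set.range m) := by
  refine le_antisymm (fun f hf => ?_) (Submodule.span_le.2 ?_)
  · rw [← sum_symmCoef_smul_m hf]
    exact Submodule.sum_mem _ fun Λ _ =>
      Submodule.smul_mem _ _ (Submodule.subset_span (Set.mem_range_self Λ))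
  · rintro _ ⟨Λ, rfl⟩
    exact m_mem_symmetric Λ

theorem map_toSubmodule_symmetric :
    (Subalgebra.toSubmodule symmetric).map sQSym.val.toLinearMap = symmetricSuper := by
  rw [toSubmodule_symmetric, Submodule.map_span, ← Set.range_comp]
  rfl

/-- A property of `m_Λ` described by a linear map extends to all symmetric functions. -/
theorem map_mem_of_symmetric {V : Type} [AddCommGroup V] [Module ℚ V] {φ : sQSym →ₗ[ℚ] V}
    {P : Submodule ℚ V} (h : ∀ Λ, φ (m Λ) ∈ P) {f : sQSym} (hf : f ∈ symmetric) : φ f ∈ P := by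
  rw [← sum_symmCoef_smul_m hf, map_sum]
  refine Submodule.sum_mem _ fun Λ _ => ?_
  rw [map_smul]
  exact P.smul_mem _ (h Λ)

end sQSym

/-! ### The coproduct of a monomial symmetric function -/

namespace Superpartition

/-- The superpartition formed by the parts in `A` and `B`. -/
def restrictTo (Λ : Superpartition) (A : Finset ℕ) (B : Multiset ℕ) : Superpartition :=
  ⟨Λ.anti ∩ A, Λ.sym ∩ B, fun h => Λ.zero_notMem (Multiset.mem_inter.1 h).1⟩

/-- The superpartition that remains when the parts in `A` and `B` are removed. -/
def remove (Λ : Superpartition) (A : Finset ℕ) (B : Multiset ℕ) : Superpartition :=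
  ⟨Λ.anti \ A, Λ.sym - B, fun h => Λ.zero_notMem (Multiset.mem_of_le (Multiset.sub_le_self _ _) h)⟩

/-- The pairs consisting of a part of the first and a part of the second partition. -/
def subparts (Λ : Superpartition) : Finset (Finset ℕ × Multiset ℕ) :=
  Λ.anti.powerset ×ˢ Λ.sym.powerset.toFinset

theorem mem_subparts {Λ : Superpartition} {p : Finset ℕ × Multiset ℕ} :
    p ∈ Λ.subparts ↔ p.1 ⊆ Λ.anti ∧ p.2 ≤ Λ.sym := by
  simp [subparts]

theorem restrictTo_anti {Λ : Superpartition} {p : Finset ℕ × Multiset ℕ} (h : p ∈ Λ.subparts) :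
    (Λ.restrictTo p.1 p.2).anti = p.1 := Finset.inter_eq_right.2 (mem_subparts.1 h).1

theorem restrictTo_sym {Λ : Superpartition} {p : Finset ℕ × Multiset ℕ} (h : p ∈ Λ.subparts) :
    (Λ.restrictTo p.1 p.2).sym = p.2 :=
   inf_eq_right.2 (mem_subparts.1 h).2

/-- The number of parts. -/
def length (Λ : Superpartition) : ℕ := Λ.anti.card + Multiset.card Λ.sym

/-- The sign of the shuffle that sorts decreasingly the concatenation of `A` and `B`, both sorted
decreasingly. -/
def shuffleSign (A B : Finset ℕ) : ℚ := ∏ x ∈ A, ∏ y ∈ B, if x < y then -1 else 1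

end Superpartition

namespace SuperSeries

variable {K : Type} [LinearOrder K] {u v : ℕ ↪o K}

theorem joinSet_sdiff (huv : IsOrderedUnion u v) (S T S' T' : Finset ℕ) :
    joinSet u v S T \ joinSet u v S' T' = joinSet u v (S \ S') (T \ T') := by
  ext x
  rcases huv.cover x with ⟨i, rfl⟩ | ⟨i, rfl⟩
  · simp only [Finset.mem_sdiff, left_mem_joinSet huv]
  · simp only [Finset.mem_sdiff, right_mem_joinSet huv]

theorem disjoint_map_map (huv : IsOrderedUnion u v) (S T : Finset ℕ) :
    Disjoint (S.map u.toEmbedding) (T.map v.toEmbedding) := by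
  rw [Finset.disjoint_left]
  intro x hx hx'
  obtain ⟨i, _, rfl⟩ := Finset.mem_map.1 hx
  obtain ⟨j, _, h⟩ := Finset.mem_map.1 hx'
  exact huv.ne i j h.symm

theorem map_joinSet_val (huv : IsOrderedUnion u v) (S T : Finset ℕ) (a b : ℕ →₀ ℕ) :
    (joinSet u v S T).val.map (joinExp u v a b) = S.val.map a + T.val.map b := by
  rw [joinSet, ← Finset.disjUnion_eq_union _ _ (disjoint_map_map huv S T), Finset.disjUnion_val,
    Multiset.map_add, Finset.map_val, Finset.map_val, Multiset.map_map, Multiset.map_map]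
  congr 1
  · exact Multiset.map_congr rfl fun i _ => joinExp_left huv a b i
  · exact Multiset.map_congr rfl fun i _ => joinExp_right huv a b i

/-- For a pair with one index in each alphabet the order of the indices is fixed, so only the
comparison of exponents remains. These cross pairs produce the shuffle sign. -/
theorem expSign_join (huv : IsOrderedUnion u v) (S T : Finset ℕ) (a b : ℕ →₀ ℕ) :
    expSign (joinSet u v S T) (joinExp u v a b) =
      (∏ x ∈ S, ∏ y ∈ T, if a x < b y then -1 else 1) * (expSign S a * expSign T b) := by
  rw [expSign, joinSet, Finset.prod_union (disjoint_map_map huv S T)]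
  simp only [Finset.prod_union (disjoint_map_map huv S T), Finset.prod_mul_distrib,
    Finset.prod_map, RelEmbedding.coe_toEmbedding, joinExp_left huv, joinExp_right huv,
    u.lt_iff_lt, v.lt_iff_lt, huv.lt, (huv.lt _ _).not_gt, true_and, false_and, if_false,
    Finset.prod_const_one, one_mul]
  rw [expSign, expSign]
  ring

theorem coeff_join_monomialSymmetric (huv : IsOrderedUnion u v) (Λ : Superpartition)
    (S T : Finset ℕ) (a b : ℕ →₀ ℕ) :
    coeff (joinSet u v S T) (joinExp u v a b) (monomialSymmetric K Λ) =
      if S.val.map a + T.val.map b = Λ.anti.val ∧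
          (a.support \ S).val.map a + (b.support \ T).val.map b = Λ.sym then
        (∏ x ∈ S, ∏ y ∈ T, if a x < b y then -1 else 1) * (expSign S a * expSign T b)
      else 0 := by
  rw [coeff_monomialSymmetric, expSign_join huv]
  refine if_congr ?_ rfl rfl
  rw [coe_shape_eq_parts_iff, map_joinSet_val huv, support_joinExp huv, joinSet_sdiff huv,
    map_joinSet_val huv]

end SuperSeries

namespace sQSym

open DottedComposition Superpartition

theorem coeff_m' (Λ : Superpartition) (S : Finset ℕ) (a : ℕ →₀ ℕ) :
    coeff S a (m Λ : SuperSeries ℕ) =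
      if S.val.map a = Λ.anti.val ∧ (a.support \ S).val.map a = Λ.sym then expSign S a else 0 := by
  rw [coeff_m]
  exact if_congr coe_shape_eq_parts_iff rfl rfl

/-- Each monomial of `m_Λ` in two alphabets tells which parts of `Λ` are used in the first one; the
remaining parts are used in the second. The sign is that of interleaving the two sets of dotted
parts. -/
theorem comul_m (Λ : Superpartition) : Coalgebra.comul (R := ℚ) (m Λ) =
    ∑ p ∈ Λ.subparts, shuffleSign p.1 (Λ.remove p.1 p.2).anti •
      (m (Λ.restrictTo p.1 p.2) ⊗ₜ[ℚ] m (Λ.remove p.1 p.2)) := by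
  refine twoAlphabets_injective ?_
  rw [twoAlphabets_comul, eval_m, map_sum]
  refine ext_join isOrderedUnion_inlEmb_inrEmb fun S T a b => ?_
  rw [coeff_join_monomialSymmetric isOrderedUnion_inlEmb_inrEmb, map_sum]
  simp only [map_smul, coeff_twoAlphabets_tmul, coeff_m', smul_eq_mul]
  have hterm : ∀ p ∈ Λ.subparts,
      S.val.map a = (Λ.restrictTo p.1 p.2).anti.val →
      (a.support \ S).val.map a = (Λ.restrictTo p.1 p.2).sym →
      S.val.map a = p.1.val ∧ (a.support \ S).val.map a = p.2 := by
    intro p hp h1 h2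
    rw [restrictTo_anti hp] at h1
    rw [restrictTo_sym hp] at h2
    exact ⟨h1, h2⟩
  split_ifs with h
  · obtain ⟨h1, h2⟩ := h
    have hA : (S.val.map a).Nodup :=
      Multiset.nodup_of_le (h1 ▸ Multiset.le_add_right _ _) Λ.anti.nodup
    -- The only pair that contributes consists of the exponents of the first-alphabet factor, with
    -- and without a `θ`.
    have hp : ((⟨S.val.map a, hA⟩, (a.support \ S).val.map a) : Finset ℕ × Multiset ℕ) ∈
        Λ.subparts := by
      refine mem_subparts.2 ⟨Finset.val_le_iff.1 ?_, ?_⟩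
      · exact h1 ▸ Multiset.le_add_right _ _
      · exact h2 ▸ Multiset.le_add_right _ _
    have hr : T.val.map b = (Λ.anti \ ⟨S.val.map a, hA⟩ : Finset ℕ).val := by
      rw [Finset.sdiff_val, ← h1, add_tsub_cancel_left]
    have hs : (b.support \ T).val.map b = Λ.sym - (a.support \ S).val.map a := by
      rw [← h2, add_tsub_cancel_left]
    rw [Finset.sum_eq_single_of_mem _ hp]
    · rw [if_pos ⟨(congrArg Finset.val (restrictTo_anti hp)).symm, (restrictTo_sym hp).symm⟩,
        if_pos ⟨hr, hs⟩]
      congr 1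
      change _ = ∏ x ∈ (⟨S.val.map a, hA⟩ : Finset ℕ),
        ∏ y ∈ (Λ.anti \ ⟨S.val.map a, hA⟩ : Finset ℕ), if x < y then (-1 : ℚ) else 1
      simp only [Finset.prod_eq_multiset_prod, ← hr, Multiset.map_map, Function.comp_def]
    · intro p hp' hne
      by_cases h3 : S.val.map a = (Λ.restrictTo p.1 p.2).anti.val ∧
          (a.support \ S).val.map a = (Λ.restrictTo p.1 p.2).sym
      · obtain ⟨h4, h5⟩ := hterm p hp' h3.1 h3.2
        exact absurd (Prod.ext (Finset.val_injective h4.symm) h5.symm) hne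
      · rw [if_neg h3, zero_mul, mul_zero]
  · symm
    refine Finset.sum_eq_zero fun p hp => ?_
    by_cases h3 : S.val.map a = (Λ.restrictTo p.1 p.2).anti.val ∧
        (a.support \ S).val.map a = (Λ.restrictTo p.1 p.2).sym
    · obtain ⟨h4, h5⟩ := hterm p hp h3.1 h3.2
      rw [if_neg (c := T.val.map b = _ ∧ _), mul_zero, mul_zero]
      rintro ⟨h6, h7⟩
      refine h ⟨?_, ?_⟩
      · rw [h4, h6, remove, Finset.sdiff_val]
        exact add_tsub_cancel_of_le (Finset.val_le_iff.2 (mem_subparts.1 hp).1)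
      · rw [h5, h7, remove]
        exact add_tsub_cancel_of_le (mem_subparts.1 hp).2
    · rw [if_neg h3, zero_mul, mul_zero]

/-! ### The Hopf subalgebra of symmetric functions -/

theorem m_eq_one {Λ : Superpartition} (h1 : Λ.anti = ∅) (h2 : Λ.sym = 0) : m Λ = 1 := by
  refine Subtype.ext (ext_coeff fun S a => ?_)
  rw [coeff_m', Subalgebra.coe_one, coeff_one, h1, h2]
  by_cases h : S = ∅ ∧ a = 0
  · rw [h.1, h.2]
    simp [expSign]
  · rw [if_neg h, if_neg]
    simp only [Finset.empty_val, Multiset.map_eq_zero, Finset.val_eq_zero]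
    rintro ⟨rfl, h3⟩
    rw [Finset.sdiff_empty, Finsupp.support_eq_empty] at h3
    exact h ⟨rfl, h3⟩

theorem comul_mem_of_mem_symmetric {f : sQSym} (hf : f ∈ symmetric) :
    Coalgebra.comul (R := ℚ) f ∈ LinearMap.range (TensorProduct.mapIncl
      (Subalgebra.toSubmodule symmetric) (Subalgebra.toSubmodule symmetric)) := by
  refine map_mem_of_symmetric (fun Λ => ?_) hf
  rw [comul_m]
  refine Submodule.sum_mem _ fun p _ => Submodule.smul_mem _ _ ?_
  exact ⟨⟨_, m_mem_symmetric _⟩ ⊗ₜ ⟨_, m_mem_symmetric _⟩, rfl⟩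

/-- In the left antipode identity at `m Λ`, the term with all parts on the left is the antipode of
`m Λ` itself. The other terms involve antipodes of `m_Γ` with fewer parts, so induction on the
number of parts solves for it inside the subalgebra. -/
theorem antipode_m_mem (Λ : Superpartition) : antipode (m Λ) ∈ symmetric := by
  induction h : Λ.length using Nat.strong_induction_on generalizing Λ with
  | _ n ih =>
    have htop : (Λ.anti, Λ.sym) ∈ Λ.subparts := mem_subparts.2 ⟨Finset.Subset.refl _, le_refl _⟩
    have h1 := LinearMap.congr_fun antipode_left (m Λ)
    simp only [LinearMap.comp_apply, comul_m, map_sum, map_smul, LinearMap.rTensor_tmul,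
      LinearMap.mul'_apply] at h1
    rw [← Finset.add_sum_erase _ _ htop] at h1
    have h2 : Λ.restrictTo Λ.anti Λ.sym = Λ := ext' (restrictTo_anti htop) (restrictTo_sym htop)
    have h3 : (Λ.remove Λ.anti Λ.sym).anti = ∅ := Finset.sdiff_self _
    have h4 : (Λ.remove Λ.anti Λ.sym).sym = 0 := tsub_self _
    have h5 : shuffleSign Λ.anti ∅ = 1 := by simp [shuffleSign]
    simp only [h2, h3, m_eq_one h3 h4, h5, one_smul, mul_one] at h1
    rw [eq_sub_of_add_eq h1]
    refine Subalgebra.sub_mem _ (Subalgebra.algebraMap_mem _ _)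
      (Subalgebra.sum_mem _ fun p hp => ?_)
    rw [Finset.mem_erase] at hp
    refine Subalgebra.smul_mem _ (Subalgebra.mul_mem _ (ih _ ?_ _ rfl) (m_mem_symmetric _)) _
    obtain ⟨hp1, hp2⟩ := mem_subparts.1 hp.2
    have c1 := Finset.card_le_card hp1
    have c2 := Multiset.card_le_card hp2
    rw [length, restrictTo_anti hp.2, restrictTo_sym hp.2, ← h, length]
    -- If no part were lost, both inclusions would be equalities and `p` would be the term already
    -- split off.
    by_contra hlt
    refine hp.1 (Prod.ext ?_ ?_)
    · exact Finset.eq_of_subset_of_card_le hp1 (by change Λ.anti.card ≤ _; omega)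
    · exact Multiset.eq_of_le_of_card_le hp2 (by change Multiset.card Λ.sym ≤ _; omega)

theorem m_mem_fermionic (Λ : Superpartition) : m Λ ∈ fermionic Λ.anti.card := by
  intro S a h
  rw [coeff_m'] at h
  have h1 : S.val.map a = Λ.anti.val := by
    by_contra h0
    exact h (if_neg fun h' => h0 h'.1)
  rw [Finset.card_def, Finset.card_def, ← h1, Multiset.card_map]

theorem decompose_mem_symmetric {f : sQSym} (hf : f ∈ symmetric) (n : ℕ) :
    (DirectSum.decompose fermionic f n : sQSym) ∈ symmetric := by
  -- The decomposition of the graded algebra was chosen from internality; it is identified with the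
  -- explicit `component` in order to be computed on `m Λ`.
  have hφ : ∀ g : sQSym, (DirectSum.decompose fermionic g n : sQSym) = component n g := by
    intro g
    refine DirectSum.Decomposition.inductionOn fermionic (by simp) (fun {i} g => ?_)
      (fun g g' h h' => ?_) g
    · rw [component_of_mem _ g.2]
      split_ifs with h
      · subst h; exact DirectSum.decompose_of_mem_same fermionic g.2
      · exact DirectSum.decompose_of_mem_ne fermionic g.2 (Ne.symm h)
    · rw [DirectSum.decompose_add, DirectSum.add_apply, Submodule.coe_add, h, h', map_add,
        Submodule.coe_add]
  rw [hφ]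
  refine map_mem_of_symmetric (φ := (fermionic n).subtype ∘ₗ component n)
    (P := Subalgebra.toSubmodule symmetric) (fun Λ => ?_) hf
  rw [LinearMap.comp_apply, Submodule.subtype_apply, component_of_mem _ (m_mem_fermionic Λ)]
  split_ifs
  · exact m_mem_symmetric Λ
  · exact Submodule.zero_mem _

theorem isSuperHopfSubalgebra : IsSuperHopfSubalgebra fermionic antipode symmetric where
  decompose_mem _ hf n := decompose_mem_symmetric hf n
  comul_mem _ hf := comul_mem_of_mem_symmetric hf
  antipode_mem _ hf := map_mem_of_symmetric (P := Subalgebra.toSubmodule symmetric)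
    antipode_m_mem hf

/-- The inclusion of the tensor square of the ring of symmetric functions in superspace. -/
noncomputable def symmetricIncl : symmetric ⊗[ℚ] symmetric →ₗ[ℚ] sQSym ⊗[ℚ] sQSym :=
  TensorProduct.map symmetric.val.toLinearMap symmetric.val.toLinearMap

/-- Modules over a field are flat. Injectivity lets the coproduct be pulled back to the tensor
square of the subalgebra. -/
theorem symmetricIncl_injective : Function.Injective symmetricIncl :=
  TensorProduct.map_injective_of_flat_flat _ _ Subtype.val_injective
    Subtype.val_injective

/-- The coproduct of the ring of symmetric functions in superspace. -/
noncomputable def symmetricComul : symmetric →ₗ[ℚ] symmetric ⊗[ℚ] symmetric :=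
  (LinearEquiv.ofInjective symmetricIncl symmetricIncl_injective).symm.toLinearMap ∘ₗ
    (Coalgebra.comul ∘ₗ symmetric.val.toLinearMap).codRestrict (LinearMap.range symmetricIncl)
      fun f => comul_mem_of_mem_symmetric f.2

theorem map_symmetricComul (f : symmetric) :
    TensorProduct.map symmetric.val.toLinearMap symmetric.val.toLinearMap (symmetricComul f) =
      Coalgebra.comul (R := ℚ) (f : sQSym) :=
  congrArg Subtype.val <|
    (LinearEquiv.ofInjective symmetricIncl symmetricIncl_injective).apply_symm_apply
      ⟨_, comul_mem_of_mem_symmetric f.2⟩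

/-! ### Power sums -/

theorem expSign_eq_one_of_card_le {I : Type} [LinearOrder I] {S : Finset I} (h : S.card ≤ 1)
    (a : I →₀ ℕ) : expSign S a = 1 := by
  refine Finset.prod_eq_one fun x hx => Finset.prod_eq_one fun y hy => ?_
  rw [Finset.card_le_one.1 h x hx y hy]
  simp

/-- With a single part there is nothing to reorder and no sign, so `M α` and `m Λ` coincide. -/
theorem M_mem_symmetric_of_length {α : DottedComposition} {Λ : Superpartition} {p : ℕ × Bool}
    (hα : α.parts = [p]) (hΛ : Λ.parts = {p}) : M α ∈ symmetric := by
  have h : M α = m Λ := by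
    refine Subtype.ext (ext_coeff fun S a => ?_)
    rw [coeff_M, coeff_m, hα, hΛ]
    simp only [Multiset.coe_eq_singleton]
    refine if_ctx_congr Iff.rfl (fun h => (expSign_eq_one_of_card_le ?_ a).symm) fun _ => rfl
    have := shape_card S a
    rw [h] at this
    simp only [List.map_cons, List.map_nil, List.sum_cons, List.sum_nil, add_zero] at this
    rw [← this]
    split_ifs <;> simp
  rw [h]
  exact m_mem_symmetric Λ

/-- For `p = (0, false)` the right side would describe the monomial `1`, whose shape is empty. -/
theorem shape_eq_singleton_iff {S : Finset ℕ} {a : ℕ →₀ ℕ} {p : ℕ × Bool} (hp : p ≠ (0, false)) :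
    shape S a = [p] ↔ ∃ i, a = Finsupp.single i p.1 ∧ S = if p.2 then {i} else ∅ := by
  constructor
  · intro h
    have hc : (a.support ∪ S).card = 1 := by
      have := congrArg List.length h
      simpa [shape] using this
    obtain ⟨i, hi⟩ := Finset.card_eq_one.1 hc
    rw [shape, hi, Finset.sort_singleton, List.map_singleton, List.singleton_inj] at h
    have ha : a.support ⊆ {i} := hi ▸ Finset.subset_union_left
    have hS : S ⊆ {i} := hi ▸ Finset.subset_union_right
    refine ⟨i, ?_, ?_⟩
    · rw [← h]
      exact Finsupp.support_subset_singleton.1 ha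
    · rw [← h]
      rcases Finset.subset_singleton_iff.1 hS with rfl | rfl <;> simp
  · rintro ⟨i, rfl, rfl⟩
    rcases p with ⟨n, b⟩
    have h : (Finsupp.single i n).support ∪ (if b then {i} else ∅) = ({i} : Finset ℕ) := by
      cases b
      · have hn : n ≠ 0 := fun h => hp (h ▸ rfl)
        simp [Finsupp.support_single _ hn]
      · exact Finset.union_eq_right.2 Finsupp.support_single_subset
    rw [shape, h]
    cases b <;> simp

theorem M_single_mem_symmetric (r : ℕ) (hr : 1 ≤ r) : M (single r hr) ∈ symmetric :=
  M_mem_symmetric_of_length (Λ := ⟨∅, {r}, by simp; omega⟩) rfl (by simp [Superpartition.parts])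

theorem M_singleDot_mem_symmetric (k : ℕ) : M (singleDot k) ∈ symmetric :=
  M_mem_symmetric_of_length (Λ := ⟨{k}, 0, by simp⟩) rfl (by simp [Superpartition.parts])

open Classical in
theorem powerSum_eq (r : ℕ) (hr : 1 ≤ r) : powerSum r = (M (single r hr) : SuperSeries ℕ) := by
  refine ext_coeff fun S a => ?_
  have h : coeff S a (powerSum r) = if S = ∅ ∧ ∃ i, a = Finsupp.single i r then 1 else 0 := rfl
  rw [coeff_M, h]
  refine if_congr ?_ rfl rfl
  rw [single, shape_eq_singleton_iff (by simp; omega)]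
  simp [and_comm]

open Classical in
theorem powerSumTilde_eq (k : ℕ) : powerSumTilde k = (M (singleDot k) : SuperSeries ℕ) := by
  refine ext_coeff fun S a => ?_
  have h : coeff S a (powerSumTilde k) =
    if ∃ i, S = {i} ∧ a = Finsupp.single i k then 1 else 0 := rfl
  rw [coeff_M, h]
  refine if_congr ?_ rfl rfl
  rw [singleDot, shape_eq_singleton_iff (by simp)]
  simp [and_comm]

end sQSym

/-! ### The main theorem -/

theorem mainTheorem4 :
    Function.Injective sQSym.twoAlphabets ∧
    ∃ (_ : Coalgebra ℚ sQSym) (S : sQSym →ₗ[ℚ] sQSym),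
      (∀ f : sQSym, sQSym.twoAlphabets (Coalgebra.comul f) = sQSym.eval (ℕ ⊕ₗ ℕ) f) ∧
      (∀ f : sQSym, Coalgebra.counit f = SuperSeries.coeff ∅ 0 (f : SuperSeries ℕ)) ∧
      (∀ α : DottedComposition,
        {p : DottedComposition × DottedComposition | p.1.append p.2 = α}.Finite ∧
        Coalgebra.comul (R := ℚ) (sQSym.M α) =
          ∑ᶠ p ∈ {p : DottedComposition × DottedComposition | p.1.append p.2 = α},
            sQSym.M p.1 ⊗ₜ[ℚ] sQSym.M p.2 ∧
        Coalgebra.comul (R := ℚ) (sQSym.M α) =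
          ∑ k ∈ Finset.range (α.parts.length + 1),
            sQSym.M (α.take k) ⊗ₜ[ℚ] sQSym.M (α.drop k)) ∧
      IsSuperHopfAlgebra sQSym.fermionic S ∧
      IsSuperCommutative sQSym.fermionic ∧
      IsGradedConnected sQSym.homogeneous ∧
      ∃ L : Subalgebra ℚ sQSym,
        (Subalgebra.toSubmodule L).map sQSym.val.toLinearMap = symmetricSuper ∧
        IsSuperHopfSubalgebra sQSym.fermionic S L ∧
        (∃ ΔL : L →ₗ[ℚ] L ⊗[ℚ] L,
          (∀ (Λ : Superpartition) (f : L), ((f : sQSym) : SuperSeries ℕ) = monomialSymmetric ℕ Λ →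
            sQSym.twoAlphabets (TensorProduct.map L.val.toLinearMap L.val.toLinearMap (ΔL f)) =
              monomialSymmetric (ℕ ⊕ₗ ℕ) Λ) ∧
          (∀ f : L, TensorProduct.map L.val.toLinearMap L.val.toLinearMap (ΔL f) =
            Coalgebra.comul (R := ℚ) (f : sQSym))) ∧
        (∀ (r : ℕ) (hr : 1 ≤ r), sQSym.M (DottedComposition.single r hr) ∈ L ∧
          powerSum r = (sQSym.M (DottedComposition.single r hr) : SuperSeries ℕ)) ∧
        (∀ k : ℕ, sQSym.M (DottedComposition.singleDot k) ∈ L ∧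
          powerSumTilde k = (sQSym.M (DottedComposition.singleDot k) : SuperSeries ℕ)) := by
  refine ⟨sQSym.twoAlphabets_injective, inferInstance, sQSym.antipode, sQSym.twoAlphabets_comul,
    fun _ => rfl, fun α => ⟨?_, sQSym.comul_M_eq_finsum α, sQSym.comul_M α⟩,
    sQSym.isSuperHopfAlgebra, sQSym.isSuperCommutative, sQSym.isGradedConnected,
    sQSym.symmetric, sQSym.map_toSubmodule_symmetric, sQSym.isSuperHopfSubalgebra,
    ⟨sQSym.symmetricComul, fun Λ f hf => ?_, sQSym.map_symmetricComul⟩,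
    fun r hr => ⟨sQSym.M_single_mem_symmetric r hr, sQSym.powerSum_eq r hr⟩,
    fun k => ⟨sQSym.M_singleDot_mem_symmetric k, sQSym.powerSumTilde_eq k⟩⟩
  · rw [sQSym.setOf_append_eq]
    exact Finset.finite_toSet _
  · have h : (f : sQSym) = sQSym.m Λ := Subtype.ext hf
    rw [sQSym.map_symmetricComul, sQSym.twoAlphabets_comul, h, sQSym.eval_m]
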